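/- There are universal constants $c, K > 0$ and $n_0$ such that the following holds for all integers $n \ge n_0$ and $d \ge 1$. Let $x_1,\dots,x_n$ be independent random vectors, each uniformly distributed on $\{-1,1\}^d$. With probability $> \frac{9}{10}$, every directed graph $G$ on the vertex set $\{1,\dots,n\}$ that is navigable for $x_1,\dots,x_n$ under the Euclidean distance has at least $K\, n^{3/2-\epsilon}$ edges, where $$\epsilon = \max\left(\frac{\log\log n}{\log n},\; c\sqrt{\frac{\log n}{d}}\right)$$ and $\log$ is the logarithm to base $2$. Here $G$ is navigable if for all $s,t\in\{1,\dots,n\}$ greedy search started at node $s$ with query $x_t$ returns the point $x_t$. Greedy search with query $q$ works as follows: at the current node $j$, stop and return $x_j$ if $j$ has no out-neighbour. Otherwise let $h$ be the out-neighbour of $j$ minimizing $\|q-x_h\|_2$ (the lowest index among the minimizers). If $\|q-x_h\|_2<\|q-x_j\|_2$, or $\|q-x_h\|_2=\|q-x_j\|_2$ and $h<j$, move to $h$ and repeat. Otherwise stop and return $x_j$. -/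

import Mathlib

open MeasureTheory ProbabilityTheory

namespace GreedySearch

variable {n : ℕ} {α : Type*}

/-- Strict priority of node `h` over node `i` for the query `q`: the point of `h` is closer to `q`,
or it is equally close and `h` has the lower id. -/
def Precedes (D : α → α → ℝ) (x : Fin n → α) (q : α) (h i : Fin n) : Prop :=
  D q (x h) < D q (x i) ∨ (D q (x h) = D q (x i) ∧ h < i)

/-- `h` is the out-neighbour of `j` whose point is closest to the query `q`, ties between closest
out-neighbours being broken in favour of the lowest id. -/
def IsBestNeighbor (G : Digraph (Fin n)) (D : α → α → ℝ) (x : Fin n → α) (q : α)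
    (j h : Fin n) : Prop :=
  G.Adj j h ∧ ∀ i, G.Adj j i → i ≠ h → Precedes D x q h i

/-- `Output G D x q s r`: greedy search in `G` for the query `q`, started at the node `s`, terminates
at the node `r`. -/
inductive Output (G : Digraph (Fin n)) (D : α → α → ℝ) (x : Fin n → α) (q : α) :
    Fin n → Fin n → Prop
  /-- A node without out-neighbours: the search ends here. -/
  | deadEnd (j : Fin n) (hj : ∀ i, ¬ G.Adj j i) : Output G D x q j j
  /-- The best out-neighbour does not improve on the current node: the search ends here. -/
  | halt (j h : Fin n) (hb : IsBestNeighbor G D x q j h) (hn : ¬ Precedes D x q h j) :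
      Output G D x q j j
  /-- The best out-neighbour improves on the current node: move there and continue. -/
  | move (j h r : Fin n) (hb : IsBestNeighbor G D x q j h) (hp : Precedes D x q h j)
      (hr : Output G D x q h r) : Output G D x q j r

/-- `G` is navigable for the points `x` under the distance `D`: for every start node `s` and every
target `t`, greedy search for the query `x t` started at `s` returns the point `x t`. -/
def Navigable (G : Digraph (Fin n)) (D : α → α → ℝ) (x : Fin n → α) : Prop :=
  ∀ s t : Fin n, ∃ r : Fin n, Output G D x (x t) s r ∧ x r = x t

/-- The number of (directed) edges. -/
noncomputable def numEdges (G : Digraph (Fin n)) : ℕ :=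
  Set.ncard {e : Fin n × Fin n | G.Adj e.1 e.2}

/-- The set `{-1, 1}^d`, as a subset of Euclidean `d`-space. -/
def signCube (d : ℕ) : Set (EuclideanSpace ℝ (Fin d)) :=
  {v | ∀ k, v k = -1 ∨ v k = 1}

end GreedySearch

/-! For `±1` vectors, closeness means large inner product. Choose `τ` so that a random point lies
within the cap `τ ≤ ⟨·, x t⟩` with probability `p` of order `n^{-1/2}`. Each target then has about
`√n` near nodes. Greedy search from such a node `s ≠ t` cannot stop at once, so `s` has an
out-neighbour `h` at least as close to `x t`, hence also near. Charge `(t, s)` to the edge `(s, h)`: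
an edge is charged only by targets near both its ends (`sum_card_le_mul_card`). If any two nodes
have at most `m` common near targets, there are at least about `n√n / m` edges.

The core is to bound `m`. Two points with inner product at most `R ≈ √(d log n)` have caps that meet
in a proportion at most `2 (1 + 4/l²)^R p²`, with `l ≈ √(d / log n)` (`sum_joint_le`). For nearly
orthogonal points this follows by averaging (`jointTail_center_le`); each further agreeing
coordinate costs a factor at most `1 + 4/l²` (`jointTail_succ_left_le`). So `m` is of order
`exp(O(log n √(log n / d))) + log n`, which is `n^ε` up to constants. A union bound over three bad
events (`freq_not_edge_bound`) makes this simultaneous for all pairs.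

If `d < 4096 log n`, the claimed bound is below one edge, and two distinct points suffice. -/

namespace GreedySearch

/-! ### Level and tail counts of sign sums -/

/-- The sum of `f (ε₁ + ⋯ + εₐ)` over all sign vectors `ε` of length `a`. -/
noncomputable def walkSum : ℕ → (ℤ → ℝ) → ℝ
  | 0, f => f 0
  | a + 1, f => walkSum a fun s => f (s + 1) + f (s - 1)

theorem walkSum_mono {a : ℕ} : ∀ {f g : ℤ → ℝ}, (∀ s, f s ≤ g s) → walkSum a f ≤ walkSum a g := by
  induction a with
  | zero => intro f g h; exact h 0
  | succ a ih => intro f g h; exact ih fun s => add_le_add (h _) (h _)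

theorem walkSum_add (a : ℕ) : ∀ f g : ℤ → ℝ,
    walkSum a (fun s => f s + g s) = walkSum a f + walkSum a g := by
  induction a with
  | zero => intro f g; rfl
  | succ a ih =>
    intro f g
    simp only [walkSum]
    rw [← ih]
    congr 1; funext s; ring

theorem walkSum_mul_const (a : ℕ) (c : ℝ) : ∀ f : ℤ → ℝ,
    walkSum a (fun s => f s * c) = walkSum a f * c := by
  induction a with
  | zero => intro f; rfl
  | succ a ih =>
    intro f
    simp only [walkSum]
    rw [← ih]
    congr 1; funext s; ring

theorem walkSum_zero (a : ℕ) : walkSum a (fun _ => 0) = 0 := by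
  simpa using walkSum_mul_const a 0 (fun _ => 0)

theorem walkSum_sum {κ : Type*} (a : ℕ) (T : Finset κ) (f : κ → ℤ → ℝ) :
    walkSum a (fun s => ∑ j ∈ T, f j s) = ∑ j ∈ T, walkSum a (f j) := by
  classical
  induction T using Finset.induction_on with
  | empty => simpa using walkSum_zero a
  | insert i T hi ih => simp only [Finset.sum_insert hi, walkSum_add, ih]

theorem walkSum_nonneg {a : ℕ} {f : ℤ → ℝ} (h : ∀ s, 0 ≤ f s) : 0 ≤ walkSum a f := by
  rw [← walkSum_zero a]; exact walkSum_mono h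

/-- The number of sign vectors of length `a` with sum `s`. -/
noncomputable def level (a : ℕ) (s : ℤ) : ℝ := walkSum a fun x => if x = s then 1 else 0

/-- The number of sign vectors of length `a` with sum at least `s`. -/
noncomputable def tail (a : ℕ) (s : ℤ) : ℝ := walkSum a fun x => if s ≤ x then 1 else 0

theorem level_nonneg (a : ℕ) (s : ℤ) : 0 ≤ level a s :=
  walkSum_nonneg fun _ => by split_ifs <;> norm_num

theorem tail_nonneg (a : ℕ) (s : ℤ) : 0 ≤ tail a s :=
  walkSum_nonneg fun _ => by split_ifs <;> norm_num

theorem level_succ (a : ℕ) (s : ℤ) : level (a + 1) s = level a (s - 1) + level a (s + 1) := by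
  simp only [level, walkSum, ← walkSum_add]
  congr 1; funext x
  congr 1 <;> (congr 1; rw [eq_iff_iff]; omega)

theorem tail_succ (a : ℕ) (s : ℤ) : tail (a + 1) s = tail a (s - 1) + tail a (s + 1) := by
  simp only [tail, walkSum, ← walkSum_add]
  congr 1; funext x
  congr 1 <;> (congr 1; rw [eq_iff_iff]; omega)

theorem tail_eq_level_add (a : ℕ) (s : ℤ) : tail a s = level a s + tail a (s + 1) := by
  simp only [tail, level, ← walkSum_add]
  congr 1; funext x
  split_ifs <;> first | omega | norm_num

theorem tail_anti (a : ℕ) {s t : ℤ} (h : s ≤ t) : tail a t ≤ tail a s :=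
  walkSum_mono fun x => by split_ifs <;> first | omega | norm_num

/-- The ratio of consecutive binomial coefficients, cross-multiplied so that the wrong parity and
the range outside `[-a, a]` need no exception. Pascal's rule adds the instances at `s - 1` and `s +
1`. -/
theorem level_ratio (a : ℕ) : ∀ s : ℤ,
    ((a : ℝ) - s) * level a s = ((a : ℝ) + s + 2) * level a (s + 2) := by
  induction a with
  | zero =>
    intro s
    simp only [level, walkSum]
    split_ifs with h1 h2 h2
    · omega
    · subst h1; norm_num
    · have : s = -2 := by omega
      subst this; norm_num
    · simp
  | succ a ih =>
    intro s
    have h1 := ih (s - 1)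
    have h2 := ih (s + 1)
    rw [level_succ, level_succ]
    have e1 : s - 1 + 2 = s + 1 := by ring
    have e2 : s + 1 + 2 = s + 2 + 1 := by ring
    have e3 : s + 2 - 1 = s + 1 := by ring
    rw [e1] at h1; rw [e2] at h2; rw [e3]
    push_cast at h1 h2 ⊢
    linear_combination h1 + h2

/-- The cap `h` makes the loss per step uniform in `s`, so that steps can be iterated. -/
theorem level_add_two_ge {a : ℕ} {s h : ℤ} (hs : -1 ≤ s) (hh : s ≤ h) (ha : 0 < a) :
    (1 - (2 * h + 2) / a) * level a s ≤ level a (s + 2) := by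
  have ha' : (0 : ℝ) < a := by exact_mod_cast ha
  have hs' : (-1 : ℝ) ≤ s := by exact_mod_cast hs
  have hh' : (s : ℝ) ≤ h := by exact_mod_cast hh
  have hpos : (0 : ℝ) < a + s + 2 := by linarith
  have hW := level_nonneg a s
  have e : level a (s + 2) = (1 - (2 * s + 2) / (a + s + 2)) * level a s := by
    have := level_ratio a s
    field_simp
    linear_combination -this
  rw [e]
  apply mul_le_mul_of_nonneg_right _ hW
  have : (2 * (s : ℝ) + 2) / (a + s + 2) ≤ (2 * h + 2) / a :=
    div_le_div₀ (by linarith) (by linarith) ha' (by linarith)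
  linarith

theorem level_add_ge {a : ℕ} {s h : ℤ} (hs : -1 ≤ s) (ha : 0 < a)
    (hδ : (2 * (h : ℝ) + 2) / a ≤ 1) (j : ℕ) (hj : s + 2 * j ≤ h + 2) :
    (1 - j * ((2 * h + 2) / a)) * level a s ≤ level a (s + 2 * j) := by
  induction j with
  | zero => simp
  | succ j ih =>
    push_cast at hj
    have h1 := ih (by omega)
    have h2 := level_add_two_ge (a := a) (s := s + 2 * j) (h := h) (by omega) (by omega) ha
    have e : s + 2 * ((j + 1 : ℕ) : ℤ) = s + 2 * j + 2 := by push_cast; ring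
    rw [e]
    refine le_trans ?_ h2
    have h3 := mul_le_mul_of_nonneg_left h1 (sub_nonneg.2 hδ)
    refine le_trans ?_ h3
    rw [← mul_assoc]
    apply mul_le_mul_of_nonneg_right _ (level_nonneg a s)
    push_cast
    rcases le_or_gt 0 ((2 * (h : ℝ) + 2) / a) with h0 | h0
    · have : 0 ≤ (j : ℝ) * (((2 * (h : ℝ) + 2) / a) * ((2 * (h : ℝ) + 2) / a)) := by positivity
      nlinarith
    · have : 0 ≤ (j : ℝ) * (((2 * (h : ℝ) + 2) / a) * ((2 * (h : ℝ) + 2) / a)) :=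
        mul_nonneg (by positivity) (mul_self_nonneg _)
      nlinarith

theorem level_add_ge_half {a : ℕ} {s h : ℤ} (hs : -1 ≤ s) (ha : 0 < a) (m j : ℕ) (hm : 1 ≤ m)
    (hjm : j ≤ m) (hj : s + 2 * j ≤ h + 2) (hh : -1 ≤ h) (hδ : 2 * (m : ℤ) * (2 * h + 2) ≤ a) :
    level a s ≤ 2 * level a (s + 2 * j) := by
  have ha' : (0 : ℝ) < a := by exact_mod_cast ha
  have hm' : (1 : ℝ) ≤ m := by exact_mod_cast hm
  have hjm' : (j : ℝ) ≤ m := by exact_mod_cast hjm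
  have hh' : (-1 : ℝ) ≤ h := by exact_mod_cast hh
  have hδ' : 2 * (m : ℝ) * (2 * h + 2) ≤ a := by exact_mod_cast hδ
  have h0 : 0 ≤ (2 * (h : ℝ) + 2) / a := by apply div_nonneg <;> linarith
  have h1 : (m : ℝ) * ((2 * (h : ℝ) + 2) / a) ≤ 1 / 2 := by
    rw [← mul_div_assoc, div_le_iff₀ ha']; linarith
  have h2 := level_add_ge (h := h) hs ha (by nlinarith) j hj
  have h3 : (j : ℝ) * ((2 * (h : ℝ) + 2) / a) ≤ 1 / 2 :=
    (mul_le_mul_of_nonneg_right hjm' h0).trans h1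
  have := level_nonneg a s
  nlinarith

/-! ### Joint tails: moving a coordinate between the two blocks -/

/-- The number of pairs of sign vectors `u`, `v` of lengths `a`, `b` with
`τ ≤ ∑ u + ∑ v` and `τ ≤ ∑ u - ∑ v`. -/
noncomputable def jointTail (τ : ℤ) (a b : ℕ) : ℝ := walkSum b fun v => tail a (τ + |v|)

theorem jointTail_nonneg (τ : ℤ) (a b : ℕ) : 0 ≤ jointTail τ a b :=
  walkSum_nonneg fun _ => tail_nonneg _ _

/-- For `v ≠ 0` the values `|v ± 1|` are `|v| ± 1`, so the extra sign has the same effect in either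
block. Only `v = 0` differs: there `|v ± 1|` are both `1`, which leaves the two levels just below `τ
+ 1`. -/
theorem jointTail_succ_left (τ : ℤ) (a b : ℕ) :
    jointTail τ (a + 1) b =
      jointTail τ a (b + 1) + level b 0 * (level a (τ - 1) + level a τ) := by
  simp only [jointTail, walkSum, level.eq_1 b, ← walkSum_mul_const, ← walkSum_add, tail_succ]
  congr 1; funext v
  rcases lt_trichotomy v 0 with h | h | h
  · rw [if_neg h.ne, abs_of_neg h, abs_of_nonpos (by omega : v + 1 ≤ 0),
      abs_of_neg (by omega : v - 1 < 0)]
    rw [zero_mul, add_zero]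
    congr 2 <;> ring
  · subst h
    have h1 := tail_eq_level_add a (τ - 1)
    have h2 := tail_eq_level_add a τ
    rw [sub_add_cancel] at h1
    simp only [abs_zero, add_zero, zero_add, zero_sub, abs_neg, abs_one, if_true, one_mul]
    linarith
  · rw [if_neg h.ne', abs_of_pos h, abs_of_nonneg (by omega : 0 ≤ v + 1),
      abs_of_nonneg (by omega : 0 ≤ v - 1)]
    rw [zero_mul, add_zero, add_comm]
    congr 2 <;> ring

theorem jointTail_le_succ_left (τ : ℤ) (a b : ℕ) :
    jointTail τ a (b + 1) ≤ jointTail τ (a + 1) b := by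
  rw [jointTail_succ_left]
  have := mul_nonneg (level_nonneg b 0) (add_nonneg (level_nonneg a (τ - 1)) (level_nonneg a τ))
  linarith

theorem tail_ge_sum_level (a : ℕ) (s : ℤ) (l : ℕ) :
    ∑ j ∈ Finset.range l, (level a (s + 2 * j) + level a (s + 2 * j + 1)) + tail a (s + 2 * l)
      = tail a s := by
  induction l with
  | zero => simp
  | succ l ih =>
    rw [Finset.sum_range_succ, ← ih, tail_eq_level_add a (s + 2 * l),
      tail_eq_level_add a (s + 2 * l + 1)]
    have e : s + 2 * ((l + 1 : ℕ) : ℤ) = s + 2 * l + 1 + 1 := by push_cast; ring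
    rw [e]; ring

/-- Only `v = 0, 2, …, 2(l - 1)` are kept, and after the last sign only `v - 1`, whose absolute
value is at most `2l`. -/
theorem jointTail_ge (τ : ℤ) (a b l : ℕ) :
    (∑ j ∈ Finset.range l, level b (2 * j)) * tail a (τ + 2 * l) ≤ jointTail τ a (b + 1) := by
  simp only [level, ← walkSum_sum, ← walkSum_mul_const, jointTail, walkSum]
  apply walkSum_mono
  intro v
  have h1 := tail_nonneg a (τ + |v + 1|)
  have h2 := tail_nonneg a (τ + |v - 1|)
  by_cases hv : ∃ j ∈ Finset.range l, v = 2 * (j : ℤ)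
  · obtain ⟨j, hj, rfl⟩ := hv
    have hj' := Finset.mem_range.1 hj
    rw [Finset.sum_eq_single j]
    · rw [if_pos rfl, one_mul]
      have : tail a (τ + 2 * l) ≤ tail a (τ + |2 * (j : ℤ) - 1|) := by
        apply tail_anti
        have : |2 * (j : ℤ) - 1| ≤ 2 * l := by rw [abs_le]; constructor <;> omega
        omega
      linarith
    · intro i _ hi
      rw [if_neg]; omega
    · intro h; exact absurd hj h
  · rw [Finset.sum_eq_zero, zero_mul]
    · linarith
    · intro j hj
      rw [if_neg]
      exact fun h => hv ⟨j, hj, h⟩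

/-- The excess in `jointTail_succ_left` is a product of single levels. Levels vary by at most a
factor two over `2l` steps, so each factor of the lower bound `jointTail_ge` contains `l` terms at
least half as large. The excess is thus at most `4/l²` of the whole. -/
theorem jointTail_succ_left_le {τ : ℤ} {a b l : ℕ} (hτ : 0 ≤ τ) (hl : 1 ≤ l)
    (ha : 4 * (l : ℤ) * (2 * τ + 8 * l + 2) ≤ a) (hb : 4 * (l : ℤ) * (2 * τ + 8 * l + 2) ≤ b) :
    jointTail τ (a + 1) b ≤ (1 + 4 / (l : ℝ) ^ 2) * jointTail τ a (b + 1) := by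
  have hl' : (1 : ℤ) ≤ l := by exact_mod_cast hl
  have hlr : (0 : ℝ) < l := by exact_mod_cast hl
  have hpos : 0 < 4 * (l : ℤ) * (2 * τ + 8 * l + 2) := by positivity
  have ha0 : 0 < a := by omega
  have hb0 : 0 < b := by omega
  have h1 : l * (level b 0 / 2) ≤ ∑ j ∈ Finset.range l, level b (2 * j) := by
    have := Finset.card_nsmul_le_sum (Finset.range l) (fun j : ℕ => level b (2 * j))
      (level b 0 / 2) (fun j hj => by
        have hj' := Finset.mem_range.1 hj
        have := level_add_ge_half (a := b) (s := 0) (h := τ + 4 * l) (by omega) hb0 (2 * l) j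
          (by omega) (by omega) (by omega) (by omega) (by push_cast; linarith)
        rw [zero_add] at this
        linarith)
    simpa [nsmul_eq_mul] using this
  have h2 : l * ((level a (τ - 1) + level a τ) / 2) ≤ tail a (τ + 2 * l) := by
    rw [← tail_ge_sum_level a (τ + 2 * l) l]
    have := Finset.card_nsmul_le_sum (Finset.range l)
      (fun j : ℕ => level a (τ + 2 * l + 2 * j) + level a (τ + 2 * l + 2 * j + 1))
      ((level a (τ - 1) + level a τ) / 2) (fun j hj => by
        have hj' := Finset.mem_range.1 hj
        -- Steps have size two, so the shells of either parity are compared with `τ` and `τ - 1`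
        -- separately.
        have t1 := level_add_ge_half (a := a) (s := τ) (h := τ + 4 * l) (by omega) ha0 (2 * l)
          (l + j) (by omega) (by omega) (by push_cast; omega) (by omega) (by push_cast; linarith)
        have t2 := level_add_ge_half (a := a) (s := τ - 1) (h := τ + 4 * l) (by omega) ha0 (2 * l)
          (l + j + 1) (by omega) (by omega) (by push_cast; omega) (by omega)
          (by push_cast; linarith)
        have e1 : τ + 2 * ((l + j : ℕ) : ℤ) = τ + 2 * l + 2 * j := by push_cast; ring
        have e2 : τ - 1 + 2 * ((l + j + 1 : ℕ) : ℤ) = τ + 2 * l + 2 * j + 1 := by push_cast; ring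
        rw [e1] at t1; rw [e2] at t2
        linarith)
    have h3 := tail_nonneg a (τ + 2 * l + 2 * l)
    simp only [nsmul_eq_mul, Finset.card_range] at this
    linarith
  have h3 := jointTail_ge τ a b l
  have hX := level_nonneg b 0
  have hY : 0 ≤ level a (τ - 1) + level a τ := add_nonneg (level_nonneg _ _) (level_nonneg _ _)
  have h4 : (l * (level b 0 / 2)) * (l * ((level a (τ - 1) + level a τ) / 2))
      ≤ jointTail τ a (b + 1) := by
    refine le_trans (mul_le_mul h1 h2 (by positivity) ?_) h3
    exact Finset.sum_nonneg fun _ _ => level_nonneg _ _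
  rw [jointTail_succ_left, add_mul, one_mul]
  refine add_le_add le_rfl ?_
  rw [div_mul_eq_mul_div, le_div_iff₀ (by positivity)]
  linarith

theorem jointTail_add_le {τ : ℤ} {l : ℕ} (hτ : 0 ≤ τ) (hl : 1 ≤ l) (a b m : ℕ)
    (ha : 4 * (l : ℤ) * (2 * τ + 8 * l + 2) ≤ a) (hb : 4 * (l : ℤ) * (2 * τ + 8 * l + 2) ≤ b) :
    jointTail τ (a + m) b ≤ (1 + 4 / (l : ℝ) ^ 2) ^ m * jointTail τ a (b + m) := by
  induction m generalizing a with
  | zero => simp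
  | succ m ih =>
    have h1 := ih (a + 1) (by push_cast; omega)
    have h2 := jointTail_succ_left_le (a := a) (b := b + m) hτ hl ha (by push_cast; omega)
    rw [show a + (m + 1) = a + 1 + m by ring, pow_succ, mul_assoc]
    exact h1.trans (mul_le_mul_of_nonneg_left h2 (by positivity))

theorem jointTail_le_add (τ : ℤ) (a b m : ℕ) :
    jointTail τ a (b + m) ≤ jointTail τ (a + m) b := by
  induction m generalizing a with
  | zero => simp
  | succ m ih =>
    have h1 := ih (a + 1)
    have h2 := jointTail_le_succ_left τ a (b + m)
    rw [show a + (m + 1) = a + 1 + m by ring]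
    exact h2.trans h1

/-! ### Size of a single tail -/

theorem tail_le_three_mul {a : ℕ} {τ : ℤ} (hτ : 0 ≤ τ) (ha : 0 < a)
    (h : 2 * (2 * τ + 4) ≤ a) : tail a τ ≤ 3 * tail a (τ + 1) := by
  have h1 := level_add_ge_half (a := a) (s := τ) (h := τ + 1) (by omega) ha 1 1 le_rfl le_rfl
    (by push_cast; omega) (by omega) (by push_cast; omega)
  have h0 := tail_eq_level_add a τ
  have h2 := tail_eq_level_add a (τ + 1)
  have h3 := tail_eq_level_add a (τ + 1 + 1)
  have h4 := tail_nonneg a (τ + 1 + 1 + 1)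
  have h5 := level_nonneg a (τ + 1)
  have e : τ + 2 * ((1 : ℕ) : ℤ) = τ + 1 + 1 := by push_cast; ring
  rw [e] at h1
  linarith

theorem walkSum_neg (a : ℕ) : ∀ f : ℤ → ℝ, walkSum a (fun s => f (-s)) = walkSum a f := by
  induction a with
  | zero => intro f; simp [walkSum]
  | succ a ih =>
    intro f
    simp only [walkSum]
    rw [← ih]
    congr 1; funext s
    rw [add_comm]
    congr 2 <;> ring

theorem walkSum_const (a : ℕ) (c : ℝ) : walkSum a (fun _ => c) = 2 ^ a * c := by
  induction a generalizing c with
  | zero => simp [walkSum]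
  | succ a ih => simp only [walkSum]; rw [ih, pow_succ]; ring

theorem two_pow_le_two_mul_tail_zero (a : ℕ) : (2 : ℝ) ^ a ≤ 2 * tail a 0 := by
  have h1 : tail a 0 = walkSum a fun x => if 0 ≤ -x then 1 else 0 :=
    (walkSum_neg a fun x => if 0 ≤ x then 1 else 0).symm
  have h2 : walkSum a (fun _ => 1) ≤ tail a 0 + walkSum a fun x => if 0 ≤ -x then 1 else 0 := by
    rw [tail, ← walkSum_add]
    exact walkSum_mono fun x => by split_ifs <;> first | omega | norm_num
  rw [walkSum_const, mul_one] at h2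
  linarith

theorem walkSum_exp (a : ℕ) (t c : ℝ) :
    walkSum a (fun s => Real.exp (t * s) * c) = (2 * Real.cosh t) ^ a * c := by
  induction a generalizing c with
  | zero => simp [walkSum]
  | succ a ih =>
    simp only [walkSum]
    rw [pow_succ, mul_assoc, ← ih]
    congr 1; funext s
    rw [Real.cosh_eq]
    push_cast
    rw [mul_add, mul_sub, sub_eq_add_neg, Real.exp_add, Real.exp_add, mul_one]
    ring

/-- The Chernoff bound with parameter `s / a`, using `cosh t ≤ exp (t² / 2)`. -/
theorem tail_le_exp {a : ℕ} (ha : 0 < a) {s : ℤ} (hs : 0 ≤ s) :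
    tail a s ≤ 2 ^ a * Real.exp (-((s : ℝ) ^ 2 / (2 * a))) := by
  have ha' : (0 : ℝ) < a := by exact_mod_cast ha
  have hs' : (0 : ℝ) ≤ s := by exact_mod_cast hs
  set t : ℝ := s / a with ht
  have ht0 : 0 ≤ t := by positivity
  have h1 : tail a s ≤ walkSum a fun x => Real.exp (t * x) * Real.exp (-(t * s)) := by
    apply walkSum_mono
    intro x
    rw [← Real.exp_add]
    split_ifs with h
    · have : (s : ℝ) ≤ x := by exact_mod_cast h
      rw [Real.one_le_exp_iff]
      nlinarith
    · positivity
  rw [walkSum_exp] at h1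
  refine h1.trans ?_
  rw [mul_pow, mul_assoc]
  gcongr
  have h2 : Real.cosh t ^ a ≤ Real.exp (t ^ 2 / 2) ^ a :=
    pow_le_pow_left₀ (Real.cosh_pos t).le (Real.cosh_le_exp_half_sq t) a
  rw [← Real.exp_nat_mul] at h2
  refine (mul_le_mul_of_nonneg_right h2 (Real.exp_pos _).le).trans ?_
  rw [← Real.exp_add]
  apply le_of_eq
  congr 1
  rw [ht]; field_simp; ring

/-! ### Counting sign vectors through walk sums -/

/-- The sum of the entries of a sign vector. -/
def signSum {ι : Type*} [Fintype ι] (z : ι → ℤˣ) : ℤ := ∑ k, (z k : ℤ)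

theorem signSum_comp {ι κ : Type*} [Fintype ι] [Fintype κ] (e : κ ≃ ι) (z : ι → ℤˣ) :
    signSum (z ∘ e) = signSum z := by
  simp only [signSum, Function.comp]
  exact e.sum_comp fun k => (z k : ℤ)

theorem sum_signSum_fin (a : ℕ) : ∀ f : ℤ → ℝ,
    ∑ z : Fin a → ℤˣ, f (signSum z) = walkSum a f := by
  induction a with
  | zero => intro f; simp [walkSum, signSum]
  | succ a ih =>
    intro f
    rw [walkSum, ← ih, ← (Fin.consEquiv fun _ => ℤˣ).sum_comp, Fintype.sum_prod_type_right]
    apply Finset.sum_congr rfl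
    intro z _
    have : (Finset.univ : Finset ℤˣ) = {1, -1} := rfl
    rw [this, Finset.sum_pair (by decide)]
    simp only [signSum, Fin.consEquiv, Equiv.coe_fn_mk, Fin.sum_univ_succ, Fin.cons_zero,
      Fin.cons_succ, Units.val_one, Units.val_neg]
    congr 2 <;> ring

theorem sum_signSum {ι : Type*} [Fintype ι] [DecidableEq ι] (f : ℤ → ℝ) :
    ∑ z : ι → ℤˣ, f (signSum z) = walkSum (Fintype.card ι) f := by
  rw [← sum_signSum_fin, ← (Equiv.arrowCongr (Fintype.equivFin ι) (Equiv.refl ℤˣ)).sum_comp]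
  apply Finset.sum_congr rfl
  intro z _
  congr 1
  exact (signSum_comp (Fintype.equivFin ι).symm z).symm

theorem card_sign_vectors (d : ℕ) : (Fintype.card (Fin d → ℤˣ) : ℝ) = 2 ^ d := by
  simp [Fintype.card_units_int]

theorem sum_le_signSum (d : ℕ) (s : ℤ) :
    ∑ z : Fin d → ℤˣ, (if s ≤ signSum z then (1 : ℝ) else 0) = tail d s :=
  sum_signSum_fin d fun x => if s ≤ x then 1 else 0

theorem sum_joint_aux {ι κ : Type*} [Fintype ι] [DecidableEq ι] [Fintype κ] [DecidableEq κ]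
    (τ : ℤ) :
    ∑ u : ι → ℤˣ, ∑ v : κ → ℤˣ,
      (if τ ≤ signSum u + signSum v ∧ τ ≤ signSum u - signSum v then (1 : ℝ) else 0)
      = jointTail τ (Fintype.card ι) (Fintype.card κ) := by
  rw [Finset.sum_comm, jointTail, ← sum_signSum (ι := κ)]
  apply Finset.sum_congr rfl
  intro v _
  rw [tail, ← sum_signSum (ι := ι)]
  apply Finset.sum_congr rfl
  intro u _
  congr 1
  rw [eq_iff_iff]
  constructor
  · rintro ⟨h1, h2⟩
    rcases abs_cases (signSum v) with ⟨h, _⟩ | ⟨h, _⟩ <;> omega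
  · intro h
    have := le_abs_self (signSum v)
    have := neg_abs_le (signSum v)
    constructor <;> omega

/-- Multiplication by `w` fixes the coordinates with `w = 1` and flips the others, so the two inner
products are the sum and the difference of the block sums. -/
theorem sum_joint {d : ℕ} (τ : ℤ) (w : Fin d → ℤˣ) :
    ∑ z : Fin d → ℤˣ, (if τ ≤ signSum z ∧ τ ≤ signSum (z * w) then (1 : ℝ) else 0)
      = jointTail τ (Fintype.card {k // w k = 1}) (Fintype.card {k // ¬ w k = 1}) := by
  rw [← sum_joint_aux, ← Fintype.sum_prod_type',
    ← (Equiv.piEquivPiSubtypeProd (fun k => w k = 1) fun _ => ℤˣ).sum_comp]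
  apply Finset.sum_congr rfl
  intro z _
  have h1 : signSum z = signSum (fun k : {k // w k = 1} => z k)
      + signSum (fun k : {k // ¬ w k = 1} => z k) := by
    simp only [signSum]
    exact (Fintype.sum_subtype_add_sum_subtype (fun k => w k = 1) fun k => (z k : ℤ)).symm
  have h2 : signSum (z * w) = signSum (fun k : {k // w k = 1} => z k)
      - signSum (fun k : {k // ¬ w k = 1} => z k) := by
    simp only [signSum]
    rw [← Fintype.sum_subtype_add_sum_subtype (fun k => w k = 1) fun k => ((z * w) k : ℤ),
      sub_eq_add_neg, ← Finset.sum_neg_distrib]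
    congr 1
    · apply Finset.sum_congr rfl
      intro k _
      simp [k.2]
    · apply Finset.sum_congr rfl
      intro k _
      have := (Int.units_eq_one_or (w k)).resolve_left k.2
      simp [this]
  rw [h1, h2]
  rfl

theorem card_eq_one_add {d : ℕ} (w : Fin d → ℤˣ) :
    Fintype.card {k // w k = 1} + Fintype.card {k // ¬ w k = 1} = d := by
  have := Fintype.card_subtype_compl (fun k => w k = 1)
  have h2 := Fintype.card_subtype_le (fun k => w k = 1)
  simp only [Fintype.card_fin] at this h2
  omega

theorem signSum_eq_card {d : ℕ} (w : Fin d → ℤˣ) :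
    signSum w = (Fintype.card {k // w k = 1} : ℤ) - Fintype.card {k // ¬ w k = 1} := by
  rw [signSum, ← Fintype.sum_subtype_add_sum_subtype (fun k => w k = 1) fun k => (w k : ℤ),
    sub_eq_add_neg]
  congr 1
  · rw [Finset.sum_congr rfl (g := fun _ => (1 : ℤ)) (fun k _ => by simp [k.2])]
    simp
  · rw [Finset.sum_congr rfl (g := fun _ => (-1 : ℤ)) (fun k _ => by
      simp [(Int.units_eq_one_or (w k)).resolve_left k.2])]
    simp

theorem sum_mul_right {d : ℕ} (y : Fin d → ℤˣ) (f : (Fin d → ℤˣ) → ℝ) :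
    ∑ z, f (z * y) = ∑ z, f z := Equiv.sum_comp (Equiv.mulRight y) f

/-- For fixed `z`, the product `z * w` runs over all sign vectors, so the two conditions decouple.
-/
theorem sum_sum_joint (d : ℕ) (τ : ℤ) :
    ∑ w : Fin d → ℤˣ, jointTail τ (Fintype.card {k // w k = 1}) (Fintype.card {k // ¬ w k = 1})
      = tail d τ ^ 2 := by
  simp only [← sum_joint]
  rw [Finset.sum_comm, sq, ← sum_le_signSum, Finset.sum_mul_sum]
  apply Finset.sum_congr rfl
  intro z _
  rw [← Equiv.sum_comp (Equiv.mulLeft z) fun w => (if τ ≤ signSum z then (1 : ℝ) else 0) *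
    if τ ≤ signSum w then 1 else 0]
  apply Finset.sum_congr rfl
  intro w _
  simp only [Equiv.coe_mulLeft]
  by_cases h1 : τ ≤ signSum z <;> by_cases h2 : τ ≤ signSum (z * w) <;> simp [h1, h2]

/-- By averaging over `w`: at least half of all `w` have nonnegative sum, and for these the agreeing
block has size at least `k`, so by monotonicity the joint tail is at least the central one. -/
theorem jointTail_center_le (d k b : ℕ) (τ : ℤ) (hk : k + b = d) (h0 : b ≤ k) (h1 : k ≤ b + 1) :
    jointTail τ k b * 2 ^ d ≤ 2 * tail d τ ^ 2 := by
  have h2 : jointTail τ k b * tail d 0 ≤ tail d τ ^ 2 := by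
    rw [← sum_sum_joint, ← sum_le_signSum, Finset.mul_sum]
    apply Finset.sum_le_sum
    intro w _
    have e1 := card_eq_one_add w
    have e2 := signSum_eq_card w
    split_ifs with h
    · rw [mul_one]
      obtain ⟨m, hm⟩ : ∃ m, Fintype.card {k // w k = 1} = k + m :=
        ⟨Fintype.card {k // w k = 1} - k, by omega⟩
      have hb : b = Fintype.card {k // ¬ w k = 1} + m := by omega
      rw [hm, hb]
      exact jointTail_le_add τ _ _ _
    · rw [mul_zero]; exact jointTail_nonneg _ _ _
  have := mul_le_mul_of_nonneg_left (two_pow_le_two_mul_tail_zero d) (jointTail_nonneg τ k b)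
  linarith

theorem jointTail_mul_two_pow_le {d l R : ℕ} {τ : ℤ} (hτ : 0 ≤ τ) (hl : 1 ≤ l)
    (hd : 16 * (l : ℤ) * (2 * τ + 8 * l + 2) ≤ d) (hR : 2 * R ≤ d) {k b : ℕ} (hkb : k + b = d)
    (hk : k ≤ b + R) :
    jointTail τ k b * 2 ^ d ≤ 2 * (1 + 4 / (l : ℝ) ^ 2) ^ R * tail d τ ^ 2 := by
  have hl0 : (0 : ℝ) ≤ 4 / (l : ℝ) ^ 2 := by positivity
  have hone : (1 : ℝ) ≤ (1 + 4 / (l : ℝ) ^ 2) ^ R := one_le_pow₀ (by linarith)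
  have hc := jointTail_center_le d ((d + 1) / 2) (d / 2) τ (by omega) (by omega) (by omega)
  have key : jointTail τ k b ≤
      (1 + 4 / (l : ℝ) ^ 2) ^ R * jointTail τ ((d + 1) / 2) (d / 2) := by
    rcases le_total k ((d + 1) / 2) with h | h
    · obtain ⟨m, hm⟩ : ∃ m, (d + 1) / 2 = k + m := ⟨(d + 1) / 2 - k, by omega⟩
      have hb : b = d / 2 + m := by omega
      have h1 : jointTail τ k b ≤ jointTail τ ((d + 1) / 2) (d / 2) := by
        rw [hm, hb]; exact jointTail_le_add _ _ _ _
      have := mul_le_mul_of_nonneg_right hone (jointTail_nonneg τ ((d + 1) / 2) (d / 2))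
      linarith
    · have hq : 4 * (4 * (l : ℤ) * (2 * τ + 8 * l + 2)) ≤ d := by linarith
      obtain ⟨m, hm⟩ : ∃ m, k = (d + 1) / 2 + m := ⟨k - (d + 1) / 2, by omega⟩
      have hb : d / 2 = b + m := by omega
      have h1 := jointTail_add_le hτ hl ((d + 1) / 2) b m (by push_cast; omega) (by omega)
      rw [hm, hb]
      refine h1.trans (mul_le_mul_of_nonneg_right ?_ (jointTail_nonneg _ _ _))
      exact pow_le_pow_right₀ (by linarith) (by omega)
  have h2 : (0 : ℝ) < 2 ^ d := by positivity
  calc jointTail τ k b * 2 ^ d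
      ≤ (1 + 4 / (l : ℝ) ^ 2) ^ R * (jointTail τ ((d + 1) / 2) (d / 2) * 2 ^ d) := by
        rw [← mul_assoc]; exact mul_le_mul_of_nonneg_right key h2.le
    _ ≤ (1 + 4 / (l : ℝ) ^ 2) ^ R * (2 * tail d τ ^ 2) := by gcongr
    _ = _ := by ring

/-- The number of sign vectors that have inner product at least `τ` with both of two given ones. -/
theorem sum_joint_le {d l R : ℕ} {τ : ℤ} (hτ : 0 ≤ τ) (hl : 1 ≤ l)
    (hd : 16 * (l : ℤ) * (2 * τ + 8 * l + 2) ≤ d) (hR : 2 * R ≤ d) (x y : Fin d → ℤˣ)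
    (hxy : signSum (x * y) ≤ R) :
    (∑ z : Fin d → ℤˣ, (if τ ≤ signSum (z * x) ∧ τ ≤ signSum (z * y) then (1 : ℝ) else 0))
      * 2 ^ d ≤ 2 * (1 + 4 / (l : ℝ) ^ 2) ^ R * tail d τ ^ 2 := by
  have h1 : (∑ z : Fin d → ℤˣ,
      (if τ ≤ signSum (z * x) ∧ τ ≤ signSum (z * y) then (1 : ℝ) else 0)) =
      ∑ z : Fin d → ℤˣ, (if τ ≤ signSum z ∧ τ ≤ signSum (z * (x * y)) then (1 : ℝ) else 0) := by
    rw [← sum_mul_right x]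
    apply Finset.sum_congr rfl
    intro z _
    have hx : x * x = 1 := by funext k; simp
    rw [mul_assoc z x x, hx, mul_one, mul_assoc z x y]
  rw [h1, sum_joint]
  have e1 := card_eq_one_add (x * y)
  have e2 := signSum_eq_card (x * y)
  exact jointTail_mul_two_pow_le hτ hl hd hR e1 (by omega)

/-! ### Proportions and conditional independence -/

open Classical in
/-- The proportion of elements of a finite type that satisfy `Q`. -/
noncomputable def freq {α : Type*} [Fintype α] (Q : α → Prop) : ℝ :=
  (∑ x : α, if Q x then (1 : ℝ) else 0) / Fintype.card α

theorem freq_le_of_le {α : Type*} [Fintype α] [Nonempty α] {Q : α → Prop} {f : α → ℝ} {c : ℝ}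
    (h0 : ∀ x, 0 ≤ f x) (h1 : ∀ x, Q x → 1 ≤ f x) (hc : ∑ x, f x ≤ c * Fintype.card α) :
    freq Q ≤ c := by
  classical
  have : (0 : ℝ) < Fintype.card α := by exact_mod_cast Fintype.card_pos
  rw [freq, div_le_iff₀ this]
  refine le_trans (Finset.sum_le_sum fun x _ => ?_) hc
  split_ifs with h
  · exact h1 x h
  · exact h0 x

theorem freq_or_le {α : Type*} [Fintype α] (Q Q' : α → Prop) :
    freq (fun x => Q x ∨ Q' x) ≤ freq Q + freq Q' := by
  classical
  rw [freq, freq, freq, ← add_div, ← Finset.sum_add_distrib]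
  gcongr with x
  by_cases h : Q x <;> by_cases h' : Q' x <;> simp [h, h']

theorem freq_mono {α : Type*} [Fintype α] {Q Q' : α → Prop} (h : ∀ x, Q x → Q' x) :
    freq Q ≤ freq Q' := by
  classical
  rw [freq, freq]
  gcongr with x
  by_cases h1 : Q x
  · simp [h1, h x h1]
  · simp only [h1, if_false]; split_ifs <;> norm_num

theorem freq_exists_mem_le {α κ : Type*} [Fintype α] (S : Finset κ) (Q : κ → α → Prop) {c : ℝ}
    (h : ∀ i ∈ S, freq (Q i) ≤ c) : freq (fun x => ∃ i ∈ S, Q i x) ≤ S.card * c := by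
  classical
  have h1 : freq (fun x => ∃ i ∈ S, Q i x) ≤ ∑ i ∈ S, freq (Q i) := by
    simp only [freq, ← Finset.sum_div]
    rw [Finset.sum_comm]
    gcongr with x
    split_ifs with hx
    · obtain ⟨i, hi, hQ⟩ := hx
      refine le_trans ?_ (Finset.single_le_sum (f := fun i => if Q i x then (1 : ℝ) else 0)
        (fun j _ => by split_ifs <;> norm_num) hi)
      simp [hQ]
    · exact Finset.sum_nonneg fun j _ => by split_ifs <;> norm_num
  refine h1.trans ((Finset.sum_le_sum h).trans ?_)
  simp

/-- Resampling one coordinate preserves the uniform measure: exchanging `x t` with the fresh value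
is an involution. -/
theorem sum_sum_update {ι V : Type*} [Fintype ι] [DecidableEq ι] [Fintype V] (t : ι)
    (F : (ι → V) → ℝ) :
    ∑ x : ι → V, ∑ z : V, F (Function.update x t z) = Fintype.card V * ∑ x, F x := by
  classical
  rw [← Fintype.sum_prod_type']
  let e : (ι → V) × V ≃ (ι → V) × V :=
    { toFun := fun p => (Function.update p.1 t p.2, p.1 t)
      invFun := fun p => (Function.update p.1 t p.2, p.1 t)
      left_inv := fun p => by simp
      right_inv := fun p => by simp }
  calc ∑ p : (ι → V) × V, F (Function.update p.1 t p.2) = ∑ p, F (e p).1 := rfl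
    _ = ∑ p : (ι → V) × V, F p.1 := e.sum_comp fun p => F p.1
    _ = _ := by
      rw [Fintype.sum_prod_type_right]
      simp

/-- Given the coordinates outside `T`, those in `T` are independent, and `G x` depends only on the
former. Resampling the elements of `T` one by one gives a factor `q` each. -/
theorem sum_prod_le {ι V : Type*} [Fintype ι] [DecidableEq ι] [Fintype V] [DecidableEq V]
    [Nonempty V] (T : Finset ι)
    (G : (ι → V) → V → ℝ) (hG0 : ∀ x z, 0 ≤ G x z)
    (hG : ∀ t ∈ T, ∀ x z v, G (Function.update x t z) v = G x v) {q : ℝ} (hq : 0 ≤ q)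
    (hS : ∀ x, ∑ z, G x z ≤ q * Fintype.card V) :
    ∑ x : ι → V, ∏ t ∈ T, G x (x t) ≤ q ^ T.card * Fintype.card (ι → V) := by
  induction T using Finset.induction_on with
  | empty => simp
  | insert t T ht ih =>
    have hV : (0 : ℝ) < Fintype.card V := by exact_mod_cast Fintype.card_pos
    have h1 := ih fun s hs => hG s (Finset.mem_insert_of_mem hs)
    have h2 := sum_sum_update t fun x : ι → V => ∏ s ∈ insert t T, G x (x s)
    have h3 : ∀ x z, ∏ s ∈ insert t T, G (Function.update x t z) (Function.update x t z s)
        = G x z * ∏ s ∈ T, G x (x s) := by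
      intro x z
      rw [Finset.prod_insert ht, Function.update_self, hG t (Finset.mem_insert_self _ _)]
      congr 1
      apply Finset.prod_congr rfl
      intro s hs
      rw [hG t (Finset.mem_insert_self _ _), Function.update_of_ne]
      rintro rfl; exact ht hs
    simp only [h3, ← Finset.sum_mul] at h2
    have h4 : ∑ x : ι → V, (∑ z, G x z) * ∏ s ∈ T, G x (x s)
        ≤ q * Fintype.card V * (q ^ T.card * Fintype.card (ι → V)) := by
      refine le_trans ?_ (mul_le_mul_of_nonneg_left h1 (by positivity))
      rw [Finset.mul_sum]
      exact Finset.sum_le_sum fun x _ => mul_le_mul_of_nonneg_right (hS x)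
        (Finset.prod_nonneg fun s _ => hG0 _ _)
    rw [h2] at h4
    rw [Finset.card_insert_of_notMem ht, pow_succ]
    refine le_of_mul_le_mul_left (h4.trans (le_of_eq ?_)) hV
    ring

/-! ### Probabilities of the bad events -/

section Events

variable {n d : ℕ}

theorem signSum_mul_comm (x y : Fin d → ℤˣ) : signSum (x * y) = signSum (y * x) := by
  rw [mul_comm]

theorem freq_signSum_gt {i j : Fin n} (hij : i ≠ j) (R : ℤ) :
    freq (fun x : Fin n → Fin d → ℤˣ => R < signSum (x i * x j)) ≤ tail d (R + 1) / 2 ^ d := by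
  have h := sum_prod_le (ι := Fin n) {j} (fun x (z : Fin d → ℤˣ) =>
      if R + 1 ≤ signSum (z * x i) then (1 : ℝ) else 0)
    (fun x z => by split_ifs <;> norm_num)
    (fun t ht x z v => by
      rw [Finset.mem_singleton] at ht
      rw [Function.update_of_ne (by rw [ht]; exact hij)])
    (q := tail d (R + 1) / 2 ^ d) (div_nonneg (tail_nonneg _ _) (by positivity))
    (fun x => by
      rw [sum_mul_right (x i) fun z => if R + 1 ≤ signSum z then (1 : ℝ) else 0,
        sum_le_signSum, card_sign_vectors, div_mul_cancel₀ _ (by positivity)])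
  simp only [Finset.prod_singleton, Finset.card_singleton, pow_one] at h
  refine freq_le_of_le (fun x => ?_) (fun x hx => ?_) h
  · split_ifs <;> norm_num
  · rw [if_pos]; rw [signSum_mul_comm]; omega

/-- The condition on `x i` and `x j` is put inside every factor, so that the bound `q` holds for
each frozen pair, the bad ones contributing zero. -/
theorem freq_joint {i j : Fin n} {τ R : ℤ} {q : ℝ} (hq : 0 ≤ q)
    (h : ∀ x y : Fin d → ℤˣ, signSum (x * y) ≤ R →
      ∑ z : Fin d → ℤˣ, (if τ ≤ signSum (z * x) ∧ τ ≤ signSum (z * y) then (1 : ℝ) else 0)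
        ≤ q * 2 ^ d) (T : Finset (Fin n)) (hi : i ∉ T) (hj : j ∉ T) :
    freq (fun x : Fin n → Fin d → ℤˣ => signSum (x i * x j) ≤ R ∧
      ∀ t ∈ T, τ ≤ signSum (x t * x i) ∧ τ ≤ signSum (x t * x j)) ≤ q ^ T.card := by
  have h := sum_prod_le (ι := Fin n) T (fun x (z : Fin d → ℤˣ) =>
      if signSum (x i * x j) ≤ R ∧ τ ≤ signSum (z * x i) ∧ τ ≤ signSum (z * x j)
        then (1 : ℝ) else 0)
    (fun x z => by split_ifs <;> norm_num)
    (fun t ht x z v => by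
      rw [Function.update_of_ne (by rintro rfl; exact hi ht),
        Function.update_of_ne (by rintro rfl; exact hj ht)])
    (q := q) hq
    (fun x => by
      by_cases hR : signSum (x i * x j) ≤ R
      · simp only [hR, true_and, card_sign_vectors]; exact h _ _ hR
      · simp only [hR, false_and, if_false, Finset.sum_const_zero]; positivity)
  refine freq_le_of_le (fun x => ?_) (fun x hx => ?_) h
  · exact Finset.prod_nonneg fun t _ => by split_ifs <;> norm_num
  · rw [Finset.prod_congr rfl (g := fun _ => (1 : ℝ)), Finset.prod_const_one]
    intro t ht
    rw [if_pos ⟨hx.1, hx.2 t ht⟩]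

theorem freq_all_eq {n d : ℕ} (i : Fin n) :
    freq (fun x : Fin n → Fin d → ℤˣ => ∀ t, x t = x i) ≤ ((2 : ℝ) ^ d)⁻¹ ^ (n - 1) := by
  have h := sum_prod_le (ι := Fin n) (Finset.univ.erase i) (fun x (z : Fin d → ℤˣ) =>
      if z = x i then (1 : ℝ) else 0)
    (fun x z => by split_ifs <;> norm_num)
    (fun t ht x z v => by rw [Function.update_of_ne (Finset.ne_of_mem_erase ht).symm])
    (q := ((2 : ℝ) ^ d)⁻¹) (by positivity)
    (fun x => by
      rw [card_sign_vectors, inv_mul_cancel₀ (by positivity)]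
      simp)
  rw [Finset.card_erase_of_mem (Finset.mem_univ _), Finset.card_univ, Fintype.card_fin] at h
  refine freq_le_of_le (fun x => ?_) (fun x hx => ?_) h
  · exact Finset.prod_nonneg fun t _ => by split_ifs <;> norm_num
  · simp [hx]

/-- The indices `s ≠ t` with `τ ≤ ⟨x s, x t⟩`. -/
def nearSet (x : Fin n → Fin d → ℤˣ) (τ : ℤ) (t : Fin n) : Finset (Fin n) :=
  (Finset.univ.erase t).filter fun s => τ ≤ signSum (x s * x t)

/-- The lower Chernoff bound with parameter `1`: each index contributes `1 - (1 - e⁻¹) p ≤ exp (-p /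
2)` to the mean of `exp (-card)`. -/
theorem freq_card_nearSet_lt (t : Fin n) (τ : ℤ) :
    freq (fun x : Fin n → Fin d → ℤˣ =>
        ((nearSet x τ t).card : ℝ) < (n - 1 : ℕ) * (tail d τ / 2 ^ d) / 4)
      ≤ Real.exp (-((n - 1 : ℕ) * (tail d τ / 2 ^ d) / 4)) := by
  set p : ℝ := tail d τ / 2 ^ d with hp
  have hp0 : 0 ≤ p := div_nonneg (tail_nonneg _ _) (by positivity)
  have he : Real.exp (-1) ≤ 1 / 2 := by
    rw [Real.exp_neg, inv_eq_one_div]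
    exact one_div_le_one_div_of_le (by norm_num) (by linarith [Real.add_one_le_exp (1 : ℝ)])
  set c : ℝ := (n - 1 : ℕ) * p / 4 with hc
  have h := sum_prod_le (ι := Fin n) (Finset.univ.erase t) (fun x (z : Fin d → ℤˣ) =>
      if τ ≤ signSum (z * x t) then Real.exp (-1) else 1)
    (fun x z => by split_ifs <;> positivity)
    (fun s hs x z v => by rw [Function.update_of_ne (Finset.ne_of_mem_erase hs).symm])
    (q := Real.exp (-(p / 2))) (by positivity)
    (fun x => by
      rw [sum_mul_right (x t) fun z => if τ ≤ signSum z then Real.exp (-1) else 1]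
      have : ∀ z : Fin d → ℤˣ, (if τ ≤ signSum z then Real.exp (-1) else 1)
          = 1 - (1 - Real.exp (-1)) * (if τ ≤ signSum z then (1 : ℝ) else 0) := by
        intro z; split_ifs <;> ring
      simp only [this]
      rw [Finset.sum_sub_distrib, ← Finset.mul_sum, sum_le_signSum]
      simp only [Finset.sum_const, Finset.card_univ, nsmul_eq_mul, mul_one]
      rw [card_sign_vectors]
      have e : tail d τ = p * 2 ^ d := by rw [hp, div_mul_cancel₀ _ (by positivity)]
      rw [e]
      have h2 : (0 : ℝ) < 2 ^ d := by positivity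
      have h3 := Real.add_one_le_exp (-(p / 2))
      have h4 : 1 - (1 - Real.exp (-1)) * p ≤ Real.exp (-(p / 2)) := by nlinarith
      nlinarith [mul_le_mul_of_nonneg_right h4 h2.le])
  rw [Finset.card_erase_of_mem (Finset.mem_univ _), Finset.card_univ, Fintype.card_fin] at h
  have hprod : ∀ x : Fin n → Fin d → ℤˣ, ∏ s ∈ Finset.univ.erase t,
      (if τ ≤ signSum (x s * x t) then Real.exp (-1) else 1)
      = Real.exp (-((nearSet x τ t).card : ℝ)) := by
    intro x
    rw [Finset.prod_ite, Finset.prod_const_one, mul_one, Finset.prod_const, ← Real.exp_nat_mul]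
    simp [nearSet]
  simp only [hprod] at h
  refine freq_le_of_le (f := fun x => Real.exp c * Real.exp (-((nearSet x τ t).card : ℝ)))
    (fun x => by positivity) (fun x hx => ?_) ?_
  · rw [← Real.exp_add, Real.one_le_exp_iff]
    linarith
  · rw [← Finset.mul_sum]
    refine (mul_le_mul_of_nonneg_left h (Real.exp_pos _).le).trans (le_of_eq ?_)
    rw [← Real.exp_nat_mul, ← mul_assoc, ← Real.exp_add]
    congr 2
    rw [hc]; ring

end Events

/-! ### Double counting of edges in a navigable graph -/

theorem sum_card_le_mul_card {n m : ℕ} (near : Fin n → Fin n → Prop) [DecidableRel near]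
    (E : Finset (Fin n × Fin n))
    (hE : ∀ t s, s ≠ t → near s t → ∃ h, (s, h) ∈ E ∧ s ≠ h ∧ near h t)
    (hm : ∀ i j, i ≠ j → (Finset.univ.filter fun t => near i t ∧ near j t).card ≤ m) :
    ∑ t, ((Finset.univ.erase t).filter fun s => near s t).card ≤ m * E.card := by
  classical
  choose! f hf1 hf2 hf3 using hE
  rw [← Finset.card_sigma]
  set A : Finset ((_ : Fin n) × Fin n) :=
    Finset.univ.sigma fun t => (Finset.univ.erase t).filter fun s => near s t with hA
  have hmem : ∀ p ∈ A, p.2 ≠ p.1 ∧ near p.2 p.1 := by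
    intro p hp
    simpa [hA] using hp
  refine Finset.card_le_mul_card_image_of_maps_to (f := fun p => (p.2, f p.1 p.2)) ?_ m ?_
  · intro p hp
    exact hf1 _ _ (hmem p hp).1 (hmem p hp).2
  · rintro ⟨i, j⟩ -
    -- `hm` says nothing about a loop, but no pair is charged to one.
    by_cases hij : i = j
    · rw [Finset.card_eq_zero.2]
      · omega
      · rw [Finset.filter_eq_empty_iff]
        intro p hp h
        rw [Prod.mk.injEq] at h
        exact hf2 _ _ (hmem p hp).1 (hmem p hp).2 (by rw [h.2, h.1, hij])
    · refine le_trans ?_ (hm i j hij)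
      refine Finset.card_le_card_of_injOn (fun p => p.1) ?_ ?_
      · intro p hp
        simp only [Finset.coe_filter, Set.mem_ofPred_eq, Prod.mk.injEq] at hp
        obtain ⟨hp, h1, h2⟩ := hp
        simp only [Finset.coe_filter, Set.mem_ofPred_eq, Finset.mem_univ, true_and]
        rw [← h1, ← h2]
        exact ⟨(hmem p hp).2, hf3 _ _ (hmem p hp).1 (hmem p hp).2⟩
      · rintro ⟨t, s⟩ hp ⟨t', s'⟩ hp' h
        simp only [Finset.coe_filter, Set.mem_ofPred_eq, Prod.mk.injEq] at hp hp' h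
        obtain rfl := h
        rw [hp.2.1, hp'.2.1]

/-- Stopping at `s` would return a point other than `x t`, so the search must make a first move. -/
theorem Navigable.exists_adj {n : ℕ} {α : Type*} {G : Digraph (Fin n)} {D : α → α → ℝ}
    {x : Fin n → α} (hG : Navigable G D x) {s t : Fin n} (hst : x s ≠ x t) :
    ∃ h, G.Adj s h ∧ Precedes D x (x t) h s := by
  obtain ⟨r, hr, hrt⟩ := hG s t
  cases hr with
  | deadEnd _ hj => exact absurd hrt hst
  | halt _ h hb hn => exact absurd hrt hst
  | move _ h _ hb hp hr => exact ⟨h, hb.1, hp⟩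

/-- The point of Euclidean space with the coordinates of a sign vector. -/
noncomputable def signPoint {d : ℕ} (z : Fin d → ℤˣ) : EuclideanSpace ℝ (Fin d) :=
  WithLp.toLp 2 fun k => ((z k : ℤ) : ℝ)

theorem signPoint_injective (d : ℕ) : Function.Injective (signPoint (d := d)) := by
  intro x y h
  funext k
  have := congrArg (fun v : EuclideanSpace ℝ (Fin d) => v k) h
  simp only [signPoint] at this
  exact Units.ext (by exact_mod_cast this)

theorem dist_signPoint_sq {d : ℕ} (x y : Fin d → ℤˣ) :
    dist (signPoint x) (signPoint y) ^ 2 = 2 * d - 2 * signSum (x * y) := by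
  rw [EuclideanSpace.dist_eq, Real.sq_sqrt (Finset.sum_nonneg fun _ _ => sq_nonneg _), signSum]
  push_cast
  have hd : (2 * d : ℝ) = ∑ _k : Fin d, 2 := by simp [mul_comm]
  rw [hd, Finset.mul_sum, ← Finset.sum_sub_distrib]
  apply Finset.sum_congr rfl
  intro k _
  rw [Real.dist_eq, sq_abs]
  rcases Int.units_eq_one_or (x k) with hx | hx <;> rcases Int.units_eq_one_or (y k) with hy | hy <;>
    simp [signPoint, hx, hy] <;> norm_num

theorem signSum_le_of_dist_le {d : ℕ} {q x y : Fin d → ℤˣ}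
    (h : dist (signPoint q) (signPoint x) ≤ dist (signPoint q) (signPoint y)) :
    signSum (y * q) ≤ signSum (x * q) := by
  have h1 := dist_signPoint_sq q x
  have h2 := dist_signPoint_sq q y
  have h3 := pow_le_pow_left₀ dist_nonneg h 2
  rw [h1, h2] at h3
  rw [signSum_mul_comm y, signSum_mul_comm x]
  have : (signSum (q * y) : ℝ) ≤ signSum (q * x) := by linarith
  exact_mod_cast this

theorem numEdges_eq_card {n : ℕ} (G : Digraph (Fin n)) :
    ∃ E : Finset (Fin n × Fin n), (∀ e, e ∈ E ↔ G.Adj e.1 e.2) ∧ numEdges G = E.card := by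
  classical
  refine ⟨Finset.univ.filter fun e => G.Adj e.1 e.2, by simp, ?_⟩
  rw [numEdges, ← Set.ncard_coe_finset]
  congr 1; ext e; simp

theorem Navigable.sum_card_nearSet_le {n d m : ℕ} {x : Fin n → Fin d → ℤˣ} {τ : ℤ}
    {G : Digraph (Fin n)} (hG : Navigable G dist fun i => signPoint (x i))
    (hinj : Function.Injective x)
    (hm : ∀ i j, i ≠ j → (Finset.univ.filter fun t =>
      τ ≤ signSum (x i * x t) ∧ τ ≤ signSum (x j * x t)).card ≤ m) :
    ∑ t, (nearSet x τ t).card ≤ m * numEdges G := by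
  obtain ⟨E, hE, hcard⟩ := numEdges_eq_card G
  rw [hcard]
  refine sum_card_le_mul_card (fun s t => τ ≤ signSum (x s * x t)) E ?_ hm
  intro t s hst hnear
  obtain ⟨h, hadj, hp⟩ := hG.exists_adj (s := s) (t := t)
    fun h => hst (hinj (signPoint_injective d h))
  refine ⟨h, (hE _).2 hadj, ?_, hnear.trans ?_⟩
  · rintro rfl
    rcases hp with h | ⟨_, h⟩ <;> exact lt_irrefl _ h
  · apply signSum_le_of_dist_le
    rcases hp with h | ⟨h, _⟩
    · exact h.le
    · exact h.le

theorem Navigable.one_le_numEdges {n d : ℕ} {x : Fin n → Fin d → ℤˣ}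
    {G : Digraph (Fin n)} (hG : Navigable G dist fun i => signPoint (x i))
    {s t : Fin n} (hst : x s ≠ x t) : 1 ≤ numEdges G := by
  obtain ⟨E, hE, hcard⟩ := numEdges_eq_card G
  obtain ⟨h, hadj, -⟩ := hG.exists_adj (s := s) (t := t)
    fun h => hst (signPoint_injective d h)
  rw [hcard, Nat.one_le_iff_ne_zero, Finset.card_ne_zero]
  exact ⟨(s, h), (hE _).2 hadj⟩

/-! ### Transfer to an arbitrary probability space -/

theorem freq_not {α : Type*} [Fintype α] [Nonempty α] (Q : α → Prop) :
    freq Q = 1 - freq fun x => ¬ Q x := by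
  classical
  have : (0 : ℝ) < Fintype.card α := by exact_mod_cast Fintype.card_pos
  rw [eq_sub_iff_add_eq, freq, freq, ← add_div, ← Finset.sum_add_distrib, div_eq_one_iff_eq this.ne']
  rw [Finset.sum_congr rfl (g := fun _ => (1 : ℝ))]
  · simp
  · intro x _; by_cases h : Q x <;> simp [h]

theorem signCube_eq_range (d : ℕ) : signCube d = Set.range (signPoint (d := d)) := by
  ext v
  constructor
  · intro hv
    refine ⟨fun k => if v k = 1 then 1 else -1, ?_⟩
    ext k
    rcases hv k with h | h
    · simp only [signPoint, h]; norm_num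
    · simp [signPoint, h]
  · rintro ⟨z, rfl⟩ k
    rcases Int.units_eq_one_or (z k) with h | h <;> simp [signPoint, h]

theorem uniformOn_signCube_singleton {d : ℕ} (z : Fin d → ℤˣ) :
    uniformOn (signCube d) {signPoint z} = ((2 : ENNReal) ^ d)⁻¹ := by
  classical
  have h : signCube d = ((Finset.univ.image (signPoint (d := d)) : Finset _) : Set _) := by
    rw [signCube_eq_range]; simp
  have h2 : ({signPoint z} : Set (EuclideanSpace ℝ (Fin d))) =
      (({signPoint z} : Finset _) : Set _) := by simp
  rw [h, h2, uniformOn_apply_finset, Finset.inter_singleton_of_mem (by simp),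
    Finset.card_image_of_injective _ (signPoint_injective d)]
  simp [Fintype.card_units_int]

/-- The event is the preimage of a finite set, hence measurable; by independence each of its points
has mass `2^{-dn}`. -/
theorem measure_exists_signPoint {n d : ℕ} {Ω : Type*} [MeasurableSpace Ω] (P : Measure Ω)
    [IsProbabilityMeasure P] (X : Fin n → Ω → EuclideanSpace ℝ (Fin d))
    (hX : ∀ i, Measurable (X i)) (hind : iIndepFun X P)
    (hunif : ∀ i, P.map (X i) = uniformOn (signCube d)) (Q : (Fin n → Fin d → ℤˣ) → Prop) :
    P {ω | ∃ x, Q x ∧ ∀ i, X i ω = signPoint (x i)} = ENNReal.ofReal (freq Q) := by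
  classical
  set φ : (Fin n → Fin d → ℤˣ) → Fin n → EuclideanSpace ℝ (Fin d) :=
    fun x i => signPoint (x i) with hφ
  have hφi : Function.Injective φ := fun x y h =>
    funext fun i => signPoint_injective d (congrFun h i)
  set A : Finset (Fin n → EuclideanSpace ℝ (Fin d)) := (Finset.univ.filter Q).image φ with hA
  have hmeas : Measurable fun ω i => X i ω := measurable_pi_lambda _ hX
  have h1 : {ω | ∃ x, Q x ∧ ∀ i, X i ω = signPoint (x i)} = (fun ω i => X i ω) ⁻¹' (A : Set _) := by
    ext ω
    simp only [Set.mem_ofPred_eq, Set.mem_preimage, hA, Finset.coe_image, Set.mem_image,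
      Finset.coe_filter, Finset.mem_univ, true_and, hφ]
    constructor
    · rintro ⟨x, hx, h⟩; exact ⟨x, hx, funext fun i => (h i).symm⟩
    · rintro ⟨x, hx, h⟩; exact ⟨x, hx, fun i => (congrFun h i).symm⟩
  have hprob : ∀ i, IsProbabilityMeasure (P.map (X i)) := fun i =>
    Measure.isProbabilityMeasure_map (hX i).aemeasurable
  rw [h1, ← Measure.map_apply hmeas A.measurableSet,
    hind.map_fun_eq_pi_map fun i => (hX i).aemeasurable, ← sum_measure_singleton, hA,
    Finset.sum_image fun x _ y _ h => hφi h]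
  simp only [Measure.pi_singleton]
  simp only [hφ, hunif, uniformOn_signCube_singleton, Finset.prod_const, Finset.sum_const,
    Finset.card_univ, Fintype.card_fin]
  rw [freq, Finset.sum_boole]
  have hc : (Fintype.card (Fin n → Fin d → ℤˣ) : ℝ) = (2 ^ d) ^ n := by
    simp [Fintype.card_units_int]
  rw [hc, ENNReal.ofReal_div_of_pos (by positivity), ENNReal.ofReal_natCast,
    ENNReal.ofReal_pow (by positivity), ENNReal.ofReal_pow (by positivity), nsmul_eq_mul,
    div_eq_mul_inv]
  simp [ENNReal.inv_pow]

theorem lt_measure_of_freq_le {n d : ℕ} {Ω : Type*} [MeasurableSpace Ω] (P : Measure Ω)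
    [IsProbabilityMeasure P] (X : Fin n → Ω → EuclideanSpace ℝ (Fin d))
    (hX : ∀ i, Measurable (X i)) (hind : iIndepFun X P)
    (hunif : ∀ i, P.map (X i) = uniformOn (signCube d))
    (Q : (Fin n → EuclideanSpace ℝ (Fin d)) → Prop)
    (hQ : freq (fun x : Fin n → Fin d → ℤˣ => ¬ Q fun i => signPoint (x i)) ≤ 1 / 20) :
    9 / 10 < P {ω | Q fun i => X i ω} := by
  have h1 := measure_exists_signPoint P X hX hind hunif fun x => Q fun i => signPoint (x i)
  rw [freq_not] at h1
  have h2 : {ω | ∃ x : Fin n → Fin d → ℤˣ, (Q fun i => signPoint (x i)) ∧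
      ∀ i, X i ω = signPoint (x i)} ⊆ {ω | Q fun i => X i ω} := by
    rintro ω ⟨x, hx, h⟩
    simpa only [Set.mem_ofPred_eq, h] using hx
  refine lt_of_lt_of_le ?_ (measure_mono h2)
  rw [h1]
  have h3 : (9 / 10 : ENNReal) = ENNReal.ofReal (9 / 10) := by
    rw [ENNReal.ofReal_div_of_pos (by norm_num)]; norm_num
  rw [h3, ENNReal.ofReal_lt_ofReal_iff_of_nonneg (by norm_num)]
  linarith

/-! ### Union bound and choice of parameters -/

/-- The bad events are: a pair with inner product above `R`, a target with few near nodes, and a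
pair with `m` common near targets besides itself. Outside them the points are distinct, because
equal ones would have inner product `d > R`, and the double count applies. -/
theorem freq_not_edge_bound {n d l R m : ℕ} {τ : ℤ} {δ₁ δ₂ δ₃ : ℝ} (hτ : 0 ≤ τ) (hl : 1 ≤ l)
    (hd : 16 * (l : ℤ) * (2 * τ + 8 * l + 2) ≤ d) (hR : 2 * R ≤ d) (hRd : R < d)
    (h₁ : (n : ℝ) ^ 2 * (tail d (R + 1) / 2 ^ d) ≤ δ₁)
    (h₂ : n * Real.exp (-((n - 1 : ℕ) * (tail d τ / 2 ^ d) / 4)) ≤ δ₂)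
    (h₃ : (n : ℝ) ^ 2 * (n.choose m *
      (2 * (1 + 4 / (l : ℝ) ^ 2) ^ R * (tail d τ / 2 ^ d) ^ 2) ^ m) ≤ δ₃) :
    freq (fun x : Fin n → Fin d → ℤˣ => ¬ ∀ G : Digraph (Fin n),
      Navigable G dist (fun i => signPoint (x i)) →
        n * ((n - 1 : ℕ) * (tail d τ / 2 ^ d) / 4) ≤ ((m : ℝ) + 1) * numEdges G)
      ≤ δ₁ + (δ₂ + δ₃) := by
  classical
  set p : ℝ := tail d τ / 2 ^ d with hp
  have hp0 : 0 ≤ p := div_nonneg (tail_nonneg _ _) (by positivity)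
  set q : ℝ := 2 * (1 + 4 / (l : ℝ) ^ 2) ^ R * p ^ 2 with hq
  have hq0 : 0 ≤ q := by positivity
  have hoff : ((Finset.univ.offDiag : Finset (Fin n × Fin n)).card : ℝ) ≤ (n : ℝ) ^ 2 := by
    rw [Finset.offDiag_card, Finset.card_univ, Fintype.card_fin, sq]
    exact_mod_cast Nat.sub_le _ _
  have e₁ : freq (fun x : Fin n → Fin d → ℤˣ =>
      ∃ e ∈ Finset.univ.offDiag, (R : ℤ) < signSum (x e.1 * x e.2)) ≤ δ₁ := by
    refine (freq_exists_mem_le (κ := Fin n × Fin n) _ _ fun e he =>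
      freq_signSum_gt (Finset.mem_offDiag.1 he).2.2 R).trans (le_trans ?_ h₁)
    exact mul_le_mul_of_nonneg_right hoff (div_nonneg (tail_nonneg _ _) (by positivity))
  have e₂ : freq (fun x : Fin n → Fin d → ℤˣ =>
      ∃ t ∈ Finset.univ, ((nearSet x τ t).card : ℝ) < (n - 1 : ℕ) * p / 4) ≤ δ₂ := by
    refine (freq_exists_mem_le (κ := Fin n) _ _ fun t _ =>
      freq_card_nearSet_lt t τ).trans (le_trans (le_of_eq ?_) h₂)
    simp [hp]
  have e₃ : freq (fun x : Fin n → Fin d → ℤˣ =>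
      ∃ e ∈ Finset.univ.offDiag, ∃ T ∈ Finset.powersetCard m ((Finset.univ.erase e.1).erase e.2),
        signSum (x e.1 * x e.2) ≤ R ∧
        ∀ t ∈ T, τ ≤ signSum (x t * x e.1) ∧ τ ≤ signSum (x t * x e.2)) ≤ δ₃ := by
    have key : ∀ e ∈ (Finset.univ.offDiag : Finset (Fin n × Fin n)),
        freq (fun x : Fin n → Fin d → ℤˣ =>
        ∃ T ∈ Finset.powersetCard m ((Finset.univ.erase e.1).erase e.2),
        signSum (x e.1 * x e.2) ≤ R ∧
        ∀ t ∈ T, τ ≤ signSum (x t * x e.1) ∧ τ ≤ signSum (x t * x e.2))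
        ≤ n.choose m * q ^ m := by
      intro e he
      refine (freq_exists_mem_le (κ := Finset (Fin n)) (c := q ^ m) _ _ fun T hT => ?_).trans ?_
      · obtain ⟨hT1, hT2⟩ := Finset.mem_powersetCard.1 hT
        rw [← hT2]
        refine freq_joint hq0 (fun x y hxy => ?_) T ?_ ?_
        · have := sum_joint_le hτ hl hd hR x y hxy
          rw [← le_div_iff₀ (by positivity)] at this
          refine this.trans (le_of_eq ?_)
          rw [hq, hp]; field_simp
        · intro h; have := hT1 h; simp at this
        · intro h; have := hT1 h; simp at this
      · apply mul_le_mul_of_nonneg_right _ (by positivity)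
        have : (Finset.powersetCard m ((Finset.univ.erase e.1).erase e.2)).card
            ≤ (Finset.powersetCard m (Finset.univ : Finset (Fin n))).card :=
          Finset.card_le_card (Finset.powersetCard_mono (Finset.subset_univ _))
        rw [Finset.card_powersetCard _ Finset.univ, Finset.card_univ, Fintype.card_fin] at this
        exact_mod_cast this
    refine (freq_exists_mem_le (κ := Fin n × Fin n) _ _ key).trans (le_trans ?_ h₃)
    exact mul_le_mul_of_nonneg_right hoff (by positivity)
  refine le_trans (freq_mono ?_) ((freq_or_le _ _).trans (add_le_add e₁
    ((freq_or_le _ _).trans (add_le_add e₂ e₃))))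
  intro x
  contrapose!
  rintro ⟨c₁, c₂, c₃⟩ G hG
  have hinner : ∀ i j, i ≠ j → signSum (x i * x j) ≤ R := fun i j hij =>
    c₁ (i, j) (by simpa using hij)
  have hinj : Function.Injective x := by
    intro i j hij
    by_contra hne
    have h := hinner i j hne
    have hx : x j * x j = 1 := by funext k; simp
    rw [hij, hx] at h
    simp [signSum] at h
    omega
  have hmult : ∀ i j, i ≠ j → (Finset.univ.filter fun t =>
      τ ≤ signSum (x i * x t) ∧ τ ≤ signSum (x j * x t)).card ≤ m + 1 := by
    intro i j hij
    set B := Finset.univ.filter fun t =>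
      τ ≤ signSum (x i * x t) ∧ τ ≤ signSum (x j * x t) with hB
    by_contra! hlt
    -- Independence requires `T` to avoid `i` and `j`; discarding both is why the bound is `m + 1`.
    have hcard : m ≤ ((B.erase i).erase j).card := by
      have h1 := Finset.pred_card_le_card_erase (s := B) (a := i)
      have h2 := Finset.pred_card_le_card_erase (s := B.erase i) (a := j)
      omega
    obtain ⟨T, hT, hTm⟩ := Finset.exists_subset_card_eq hcard
    obtain ⟨t, htT, ht⟩ := c₃ (i, j) (by simpa using hij) T
      (Finset.mem_powersetCard.2 ⟨hT.trans (Finset.erase_subset_erase _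
        (Finset.erase_subset_erase _ (Finset.subset_univ _))), hTm⟩) (hinner i j hij)
    have htB : t ∈ B := Finset.mem_of_mem_erase (Finset.mem_of_mem_erase (hT htT))
    rw [hB, Finset.mem_filter, signSum_mul_comm (x i), signSum_mul_comm (x j)] at htB
    exact absurd htB.2.2 (not_le.2 (ht htB.2.1))
  have h := hG.sum_card_nearSet_le hinj hmult
  have h' : (∑ t, ((nearSet x τ t).card : ℝ)) ≤ ((m : ℝ) + 1) * numEdges G := by exact_mod_cast h
  refine le_trans ?_ h'
  have := Finset.card_nsmul_le_sum Finset.univ (fun t => ((nearSet x τ t).card : ℝ))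
    ((n - 1 : ℕ) * p / 4) fun t ht => c₂ t ht
  simpa [nsmul_eq_mul] using this

/-- The largest threshold whose tail probability is at least `n^{-1/2}`, in the regime where `d` is
large compared to `log n`. -/
theorem exists_threshold {d : ℕ} {Λ : ℝ} (hΛ : 2 ≤ Λ) (hd : 4096 * Λ ≤ d) :
    ∃ τ : ℕ, (τ : ℝ) ≤ Real.sqrt (d * Λ) ∧ Real.exp (-(Λ / 2)) ≤ tail d τ / 2 ^ d ∧
      tail d τ / 2 ^ d ≤ 3 * Real.exp (-(Λ / 2)) := by
  classical
  have hd0 : (0 : ℝ) < d := by linarith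
  have hd0' : 0 < d := by exact_mod_cast hd0
  have h2 : (0 : ℝ) < 2 ^ d := by positivity
  have hexp : ∀ s : ℕ, Real.exp (-(Λ / 2)) ≤ tail d s / 2 ^ d → (s : ℝ) ≤ Real.sqrt (d * Λ) := by
    intro s hs
    have h3 := tail_le_exp hd0' (s := s) (by positivity)
    rw [mul_comm, ← div_le_iff₀ h2] at h3
    have h4 := Real.exp_le_exp.1 (hs.trans h3)
    apply Real.le_sqrt_of_sq_le
    rw [neg_le_neg_iff, div_le_iff₀ (by positivity)] at h4
    push_cast at h4
    linarith
  have hex : ∃ s : ℕ, ¬ Real.exp (-(Λ / 2)) ≤ tail d s / 2 ^ d := by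
    refine ⟨⌈Real.sqrt (d * Λ)⌉₊ + 1, fun h => ?_⟩
    have h3 := hexp _ h
    have h4 := Nat.le_ceil (Real.sqrt (d * Λ))
    push_cast at h3
    linarith
  have hne : Nat.find hex ≠ 0 := by
    intro h
    have h3 := Nat.find_spec hex
    rw [h] at h3
    apply h3
    rw [Nat.cast_zero, le_div_iff₀ h2]
    have h4 := two_pow_le_two_mul_tail_zero d
    have h5 : Real.exp (-(Λ / 2)) ≤ 1 / 2 := by
      rw [Real.exp_neg, inv_eq_one_div]
      exact one_div_le_one_div_of_le (by norm_num) (by linarith [Real.add_one_le_exp (Λ / 2)])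
    nlinarith
  obtain ⟨τ, hτ⟩ := Nat.exists_eq_succ_of_ne_zero hne
  have h3 := Nat.find_spec hex
  have h4 : Real.exp (-(Λ / 2)) ≤ tail d τ / 2 ^ d :=
    not_not.1 (Nat.find_min hex (by omega : τ < Nat.find hex))
  rw [hτ] at h3
  refine ⟨τ, hexp τ h4, h4, ?_⟩
  -- This keeps `τ` where one step lowers the tail by at most a factor three.
  have h5 : (64 * τ : ℝ) ≤ d := by
    have h6 := pow_le_pow_left₀ (by positivity) (hexp τ h4) 2
    rw [Real.sq_sqrt (by positivity)] at h6
    apply le_of_sq_le_sq _ hd0.le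
    nlinarith
  have h6 : 64 * τ ≤ d := by exact_mod_cast h5
  have h7 : (8192 : ℝ) ≤ d := by linarith
  have h8 : 8192 ≤ d := by exact_mod_cast h7
  have h9 := tail_le_three_mul (a := d) (τ := τ) (by omega) hd0' (by omega)
  push_cast at h3
  have h10 := (not_le.1 h3).le
  rw [div_le_iff₀ h2] at h10 ⊢
  linarith

/-- One term of the series of `exp (e² n q)` gives `(e² n q)^m / m! ≤ e^m`, as `e² ≤ 8`; divide by
`e^{2m}`. -/
theorem choose_mul_pow_le {n m : ℕ} {q : ℝ} (hq : 0 ≤ q) (hm : 8 * (n * q) ≤ m) :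
    n.choose m * q ^ m ≤ Real.exp (-m) := by
  have h1 : (n.choose m : ℝ) ≤ (n : ℝ) ^ m / m.factorial := Nat.choose_le_pow_div m n
  have h2 := Real.pow_div_factorial_le_exp (x := Real.exp 2 * (n * q)) (by positivity) m
  have h3 : Real.exp 2 ≤ 8 := by
    have : Real.exp 2 = Real.exp 1 * Real.exp 1 := by rw [← Real.exp_add]; norm_num
    have := Real.exp_one_lt_d9
    have := Real.exp_pos 1
    nlinarith
  have h4 : Real.exp 2 * (n * q) ≤ m :=
    (mul_le_mul_of_nonneg_right h3 (by positivity)).trans hm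
  have h5 : (Real.exp 2) ^ m = Real.exp m * Real.exp m := by
    rw [← Real.exp_nat_mul, ← Real.exp_add]; congr 1; ring
  have h6 := h2.trans (Real.exp_le_exp.2 h4)
  have h7 : (0 : ℝ) < Real.exp m := Real.exp_pos _
  rw [mul_pow, h5, mul_div_assoc, mul_assoc] at h6
  have h8 := le_of_mul_le_mul_left (h6.trans_eq (mul_one _).symm) h7
  rw [Real.exp_neg, inv_eq_one_div, le_div_iff₀ h7]
  calc n.choose m * q ^ m * Real.exp m ≤ (n : ℝ) ^ m / m.factorial * q ^ m * Real.exp m := by gcongr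
    _ = Real.exp m * ((n * q) ^ m / m.factorial) := by rw [mul_pow]; ring
    _ ≤ 1 := h8

/-- The number of shells used in the comparison of joint tails. -/
theorem exists_shell_number {d τ : ℕ} {Λ : ℝ} (hΛ : 2 ≤ Λ) (hd : 4096 * Λ ≤ d)
    (hτ : (τ : ℝ) ≤ Real.sqrt (d * Λ)) :
    ∃ l : ℕ, 1 ≤ l ∧ 16 * (l : ℤ) * (2 * τ + 8 * l + 2) ≤ d ∧
      4 / (l : ℝ) ^ 2 ≤ 65536 * (Λ / d) := by
  have hd0 : (0 : ℝ) < d := by linarith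
  set B : ℝ := Real.sqrt (d / Λ) with hB
  have hBsq : B ^ 2 = d / Λ := Real.sq_sqrt (by positivity)
  have hBsq' : B ^ 2 * Λ = d := by rw [hBsq]; field_simp
  have hB64 : 64 ≤ B := by
    apply Real.le_sqrt_of_sq_le
    rw [le_div_iff₀ (by linarith)]; linarith
  have hA : Real.sqrt (d * Λ) = B * Λ := by
    rw [show (d : ℝ) * Λ = (B * Λ) ^ 2 by rw [mul_pow, ← hBsq']; ring]
    exact Real.sqrt_sq (by positivity)
  rw [hA] at hτ
  have h1 : (⌊B / 64⌋₊ : ℝ) ≤ B / 64 := Nat.floor_le (by positivity)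
  have h2 := Nat.lt_floor_add_one (B / 64)
  have h3 : 1 ≤ ⌊B / 64⌋₊ := Nat.one_le_floor_iff _ |>.2 (by linarith)
  set l := ⌊B / 64⌋₊ with hl
  have h3' : (1 : ℝ) ≤ l := by exact_mod_cast h3
  refine ⟨l, h3, ?_, ?_⟩
  · have : 16 * (l : ℝ) * (2 * τ + 8 * l + 2) ≤ d := by
      have h4 : 16 * (l : ℝ) * (2 * τ + 8 * l + 2)
          ≤ 16 * (B / 64) * (2 * (B * Λ) + 8 * (B / 64) + 2) := by gcongr
      refine h4.trans ?_
      nlinarith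
    exact_mod_cast this
  -- Since `B / 64 ≥ 1`, the floor loses at most a factor two; `65536 = 4 · 128²`.
  · have h4 : B / 128 ≤ l := by linarith
    have h5 : (B / 128) ^ 2 ≤ (l : ℝ) ^ 2 := pow_le_pow_left₀ (by positivity) h4 2
    have h6 : Λ / d = 1 / B ^ 2 := by rw [hBsq]; field_simp
    rw [h6, mul_one_div, div_le_div_iff₀ (by positivity) (by positivity)]
    nlinarith

set_option maxHeartbeats 1000000 in
theorem freq_not_edge_bound_of_large_dim {n d : ℕ} (hn : 10 ^ 7 ≤ n)
    (hd : 4096 * Real.log n ≤ d) :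
    freq (fun x : Fin n → Fin d → ℤˣ => ¬ ∀ G : Digraph (Fin n),
      Navigable G dist (fun i => signPoint (x i)) →
        (n : ℝ) * Real.sqrt n / 8 ≤
          (144 * Real.exp (196608 * (Real.log n * Real.sqrt (Real.log n / d)))
            + 4 * Real.log n + 2) * numEdges G) ≤ 1 / 20 := by
  have hn' : (10 ^ 7 : ℝ) ≤ n := by exact_mod_cast hn
  have hn0 : (0 : ℝ) < n := by linarith
  set Λ : ℝ := Real.log n with hΛdef
  have hΛ : 2 ≤ Λ := by
    rw [hΛdef, Real.le_log_iff_exp_le hn0]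
    have : Real.exp 2 = Real.exp 1 * Real.exp 1 := by rw [← Real.exp_add]; norm_num
    have := Real.exp_one_lt_d9
    have := Real.exp_pos 1
    nlinarith
  have hd0 : (0 : ℝ) < d := by linarith
  have hd0' : 0 < d := by exact_mod_cast hd0
  have h2d : (0 : ℝ) < 2 ^ d := by positivity
  have hexpΛ : Real.exp Λ = n := Real.exp_log hn0
  set r : ℝ := Real.sqrt n with hr
  have hr0 : 0 < r := Real.sqrt_pos.2 hn0
  have hrr : r * r = n := Real.mul_self_sqrt hn0.le
  have hexpr : Real.exp (-(Λ / 2)) = 1 / r := by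
    rw [Real.exp_neg, Real.exp_half, hexpΛ, one_div]
  obtain ⟨τ, hτ, hp1, hp2⟩ := exists_threshold hΛ hd
  obtain ⟨l, hl, hld, hl4⟩ := exists_shell_number hΛ hd hτ
  rw [hexpr] at hp1 hp2
  set p : ℝ := tail d τ / 2 ^ d with hp
  have hp0 : 0 ≤ p := (by positivity : 0 ≤ 1 / r).trans hp1
  -- With this `R` the tail beyond it is at most `n⁻⁴`, which survives the union over `n²` pairs.
  set R : ℕ := ⌊Real.sqrt (8 * (d * Λ))⌋₊ with hR
  have hR1 : (R : ℝ) ≤ Real.sqrt (8 * (d * Λ)) := Nat.floor_le (Real.sqrt_nonneg _)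
  have hR2 : 8 * (d * Λ) ≤ ((R : ℝ) + 1) ^ 2 := by
    have := pow_le_pow_left₀ (Real.sqrt_nonneg _) (Nat.lt_floor_add_one
      (Real.sqrt (8 * (d * Λ)))).le 2
    rwa [Real.sq_sqrt (by positivity)] at this
  have hR3 : (R : ℝ) ≤ 3 * (d * Real.sqrt (Λ / d)) := by
    refine hR1.trans (Real.sqrt_le_iff.2 ⟨by positivity, ?_⟩)
    rw [mul_pow, mul_pow, Real.sq_sqrt (by positivity)]
    have : (d : ℝ) ^ 2 * (Λ / d) = d * Λ := by field_simp
    rw [this]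
    nlinarith
  have hs : Real.sqrt (Λ / d) ≤ 1 / 64 := by
    rw [Real.sqrt_le_iff]
    refine ⟨by norm_num, ?_⟩
    rw [div_le_iff₀ hd0]; linarith
  have hRd : 2 * (R : ℝ) < d := by nlinarith
  have hRd' : 2 * R < d := by exact_mod_cast hRd
  have hδ : (1 + 4 / (l : ℝ) ^ 2) ^ R ≤ Real.exp (196608 * (Λ * Real.sqrt (Λ / d))) := by
    have h1 : 1 + 4 / (l : ℝ) ^ 2 ≤ Real.exp (4 / (l : ℝ) ^ 2) := by
      linarith [Real.add_one_le_exp (4 / (l : ℝ) ^ 2)]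
    refine (pow_le_pow_left₀ (by positivity) h1 R).trans ?_
    rw [← Real.exp_nat_mul, Real.exp_le_exp]
    calc (R : ℝ) * (4 / (l : ℝ) ^ 2) ≤ 3 * (d * Real.sqrt (Λ / d)) * (65536 * (Λ / d)) := by gcongr
      _ = _ := by field_simp; norm_num
  set E : ℝ := Real.exp (196608 * (Λ * Real.sqrt (Λ / d))) with hE
  have hE0 : 0 < E := Real.exp_pos _
  -- `144 E` is `8` times the bound `18 E` on `n q`, as `choose_mul_pow_le` requires; `4 Λ` makes
  -- `e^{-m} ≤ n⁻⁴`.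
  set m : ℕ := ⌈144 * E + 4 * Λ⌉₊ with hm
  have hm1 : 144 * E + 4 * Λ ≤ m := Nat.le_ceil _
  have hm2 : (m : ℝ) < 144 * E + 4 * Λ + 1 := Nat.ceil_lt_add_one (by positivity)
  set q : ℝ := 2 * (1 + 4 / (l : ℝ) ^ 2) ^ R * p ^ 2 with hq
  have hq0 : 0 ≤ q := by positivity
  have hnq : (n : ℝ) * q ≤ 18 * E := by
    have h1 : p ^ 2 ≤ 9 * (1 / n) := by
      have := pow_le_pow_left₀ hp0 hp2 2
      rw [← hrr]
      refine this.trans (le_of_eq ?_)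
      field_simp
      norm_num
    calc (n : ℝ) * q ≤ n * (2 * E * (9 * (1 / n))) := by rw [hq]; gcongr
      _ = 18 * E := by field_simp; norm_num
  have hexp4 : Real.exp (-(4 * Λ)) = 1 / (n : ℝ) ^ 4 := by
    rw [Real.exp_neg, one_div, ← hexpΛ, ← Real.exp_nat_mul]; norm_num
  have hsmall : (n : ℝ) ^ 2 * (1 / (n : ℝ) ^ 4) ≤ 1 / 60 := by
    have : (n : ℝ) ^ 2 * (1 / (n : ℝ) ^ 4) = 1 / (n : ℝ) ^ 2 := by field_simp
    rw [this]
    exact one_div_le_one_div_of_le (by norm_num) (by nlinarith)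
  have hcast : ((n - 1 : ℕ) : ℝ) = n - 1 := by
    rw [Nat.cast_sub (by omega)]; norm_num
  have hnp : r / 2 ≤ (n - 1 : ℕ) * p := by
    rw [hcast]
    have h1 : ((n : ℝ) - 1) * (1 / r) ≤ ((n : ℝ) - 1) * p :=
      mul_le_mul_of_nonneg_left hp1 (by linarith)
    refine le_trans ?_ h1
    rw [mul_one_div, le_div_iff₀ hr0]
    linarith
  have h₁ : (n : ℝ) ^ 2 * (tail d (R + 1) / 2 ^ d) ≤ 1 / 60 := by
    refine le_trans (mul_le_mul_of_nonneg_left ?_ (by positivity)) hsmall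
    rw [div_le_iff₀ h2d, ← hexp4, mul_comm]
    refine (tail_le_exp hd0' (s := R + 1) (by positivity)).trans ?_
    gcongr
    rw [le_div_iff₀ (by positivity)]
    push_cast
    linarith
  have h₂ : n * Real.exp (-((n - 1 : ℕ) * p / 4)) ≤ 1 / 60 := by
    have h1 : Real.exp (-((n - 1 : ℕ) * p / 4)) ≤ Real.exp (-(r / 8)) :=
      Real.exp_le_exp.2 (by linarith)
    -- The fourth-order term is of order `n²`, enough to absorb the union over `n` targets.
    have h2 := Real.pow_div_factorial_le_exp (x := r / 8) (by positivity) 4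
    have h3 : (r / 8) ^ 4 / (Nat.factorial 4 : ℕ) = (n : ℝ) ^ 2 / 98304 := by
      rw [← hrr]; simp only [Nat.factorial]; push_cast; ring
    rw [h3] at h2
    refine (mul_le_mul_of_nonneg_left h1 hn0.le).trans ?_
    rw [Real.exp_neg, ← div_eq_mul_inv, div_le_iff₀ (Real.exp_pos _)]
    have h4 : (10 : ℝ) ^ 7 * n ≤ (n : ℝ) ^ 2 := by
      rw [sq]; exact mul_le_mul_of_nonneg_right hn' hn0.le
    linarith
  have h₃ : (n : ℝ) ^ 2 * (n.choose m * q ^ m) ≤ 1 / 60 := by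
    refine le_trans (mul_le_mul_of_nonneg_left ?_ (by positivity)) hsmall
    refine (choose_mul_pow_le hq0 (by linarith)).trans ?_
    rw [← hexp4, Real.exp_le_exp]
    linarith
  have hfinal := freq_not_edge_bound (n := n) (by positivity) hl hld hRd'.le (by omega) h₁ h₂ h₃
  refine (freq_mono fun x => ?_).trans (hfinal.trans (by norm_num))
  refine mt fun h G hG => ?_
  have h1 := h G hG
  have h2 : (n : ℝ) * r / 8 ≤ n * ((n - 1 : ℕ) * p / 4) := by
    rw [mul_div_assoc]
    exact mul_le_mul_of_nonneg_left (by linarith) hn0.le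
  refine h2.trans (h1.trans ?_)
  apply mul_le_mul_of_nonneg_right _ (by positivity)
  linarith

theorem freq_all_eq_le {n d : ℕ} (hn : 6 ≤ n) (hd : 1 ≤ d) (i : Fin n) :
    freq (fun x : Fin n → Fin d → ℤˣ => ∀ t, x t = x i) ≤ 1 / 20 := by
  refine (freq_all_eq i).trans ?_
  have h1 : ((2 : ℝ) ^ d)⁻¹ ≤ 1 / 2 := by
    rw [inv_eq_one_div]
    exact one_div_le_one_div_of_le (by norm_num) (le_self_pow₀ (by norm_num) (by omega))
  calc ((2 : ℝ) ^ d)⁻¹ ^ (n - 1) ≤ (1 / 2) ^ (n - 1) := pow_le_pow_left₀ (by positivity) h1 _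
    _ ≤ (1 / 2) ^ 5 := pow_le_pow_of_le_one (by norm_num) (by norm_num) (by omega)
    _ ≤ _ := by norm_num

/-! ### Conversion to the exponent `3/2 - ε` -/

/-- The exponent loss `max (log log n / log n) (c √(log n / d))`, with logarithms to base `2`. -/
noncomputable def exponentLoss (c : ℝ) (n d : ℕ) : ℝ :=
  max (Real.logb 2 (Real.logb 2 n) / Real.logb 2 n) (c * Real.sqrt (Real.logb 2 n / d))

theorem log_le_logb_two {n : ℕ} (hn : 1 ≤ n) : Real.log n ≤ Real.logb 2 n := by
  have h1 : 0 ≤ Real.log n := Real.log_nonneg (by exact_mod_cast hn)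
  have h2 : 0 < Real.log 2 := Real.log_pos (by norm_num)
  rw [Real.logb, le_div_iff₀ h2]
  have := Real.log_two_lt_d9
  nlinarith

theorem log_le_rpow_exponentLoss {n : ℕ} (hn : 2 ≤ n) (c : ℝ) (d : ℕ) :
    Real.log n ≤ (n : ℝ) ^ exponentLoss c n d := by
  have hn' : (1 : ℝ) < n := by exact_mod_cast hn
  have h1 : 0 < Real.logb 2 n := Real.logb_pos (by norm_num) hn'
  refine (log_le_logb_two (by omega)).trans ?_
  have h2 : (n : ℝ) ^ (Real.logb 2 (Real.logb 2 n) / Real.logb 2 n) = Real.logb 2 n := by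
    conv_lhs => rw [← Real.rpow_logb (b := 2) (x := n) (by norm_num) (by norm_num) (by linarith)]
    rw [← Real.rpow_mul (by norm_num), Real.logb_rpow (by norm_num) (by norm_num),
      mul_div_cancel₀ _ h1.ne', Real.rpow_logb (by norm_num) (by norm_num) h1]
  calc Real.logb 2 n = _ := h2.symm
    _ ≤ _ := Real.rpow_le_rpow_of_exponent_le hn'.le (le_max_left _ _)

theorem exp_le_rpow_exponentLoss {n : ℕ} (hn : 2 ≤ n) {c : ℝ} (hc : 0 ≤ c) (d : ℕ) :
    Real.exp (c * (Real.log n * Real.sqrt (Real.log n / d))) ≤ (n : ℝ) ^ exponentLoss c n d := by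
  have hn' : (1 : ℝ) < n := by exact_mod_cast hn
  rw [Real.rpow_def_of_pos (by linarith), Real.exp_le_exp]
  have h1 : c * Real.sqrt (Real.log n / d) ≤ exponentLoss c n d := by
    refine le_trans ?_ (le_max_right _ _)
    have := log_le_logb_two (n := n) (by omega)
    gcongr
  have := mul_le_mul_of_nonneg_left h1 (Real.log_pos hn').le
  linarith

/-- In low dimension the loss is at least `196608 / 64`, which exceeds `3/2`. -/
theorem rpow_sub_exponentLoss_le_one {n d : ℕ} (hn : 2 ≤ n) (hd : 1 ≤ d)
    (h : (d : ℝ) < 4096 * Real.log n) :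
    (n : ℝ) ^ ((3 : ℝ) / 2 - exponentLoss 196608 n d) ≤ 1 := by
  have hn' : (1 : ℝ) ≤ n := by exact_mod_cast (by omega : 1 ≤ n)
  have hd' : (0 : ℝ) < d := by exact_mod_cast hd
  refine Real.rpow_le_one_of_one_le_of_nonpos hn' ?_
  have h1 : (1 / 64 : ℝ) ≤ Real.sqrt (Real.logb 2 n / d) := by
    apply Real.le_sqrt_of_sq_le
    rw [le_div_iff₀ hd']
    have := log_le_logb_two (n := n) (by omega)
    linarith
  have h2 : 196608 * Real.sqrt (Real.logb 2 n / d) ≤ exponentLoss 196608 n d := le_max_right _ _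
  linarith

theorem freq_not_edge_rpow_bound {n d : ℕ} (hn : 10 ^ 7 ≤ n) (hd : 1 ≤ d) :
    freq (fun x : Fin n → Fin d → ℤˣ => ¬ ∀ G : Digraph (Fin n),
      Navigable G dist (fun i => signPoint (x i)) →
        1 / 1200 * (n : ℝ) ^ ((3 : ℝ) / 2 - exponentLoss 196608 n d) ≤ numEdges G) ≤ 1 / 20 := by
  have hn0 : (0 : ℝ) < n := by exact_mod_cast (by omega : 0 < n)
  rcases lt_or_ge (d : ℝ) (4096 * Real.log n) with h | h
  · refine (freq_mono fun x => ?_).trans (freq_all_eq_le (n := n) (by omega) hd ⟨0, by omega⟩)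
    contrapose!
    rintro ⟨t, ht⟩ G hG
    have h1 : (1 : ℝ) ≤ numEdges G := by exact_mod_cast hG.one_le_numEdges ht
    have h2 := rpow_sub_exponentLoss_le_one (n := n) (by omega) hd h
    linarith
  · refine (freq_mono fun x => ?_).trans (freq_not_edge_bound_of_large_dim hn h)
    refine mt fun h G hG => ?_
    have h1 := h G hG
    have h2 := log_le_rpow_exponentLoss (n := n) (by omega) 196608 d
    have h3 := exp_le_rpow_exponentLoss (n := n) (by omega) (c := 196608) (by norm_num) d
    have h4 : 1 ≤ Real.log n := by
      rw [Real.le_log_iff_exp_le hn0]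
      have h5 := Real.exp_one_lt_d9
      have h6 : (10 ^ 7 : ℝ) ≤ n := by exact_mod_cast hn
      linarith
    set w : ℝ := (n : ℝ) ^ exponentLoss 196608 n d with hw
    have hw0 : 0 < w := by positivity
    -- `150 = 144 + 4 + 2`, the last using `1 ≤ log n ≤ w`; hence the constant `1 / (8 · 150)`.
    have h5 : (n : ℝ) * Real.sqrt n / 8 ≤ 150 * w * numEdges G :=
      h1.trans (mul_le_mul_of_nonneg_right (by linarith) (by positivity))
    have h6 : (n : ℝ) ^ ((3 : ℝ) / 2) = n * Real.sqrt n := by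
      rw [Real.sqrt_eq_rpow, show (3 : ℝ) / 2 = 1 + 1 / 2 by norm_num, Real.rpow_add hn0,
        Real.rpow_one]
    rw [Real.rpow_sub hn0, h6, ← hw, ← mul_div_assoc, div_le_iff₀ hw0]
    linarith

end GreedySearch

theorem theorem3 :
    ∃ c K : ℝ, 0 < c ∧ 0 < K ∧ ∃ n₀ : ℕ, ∀ n : ℕ, n₀ ≤ n → ∀ d : ℕ, 1 ≤ d →
      ∀ (Ω : Type*) [MeasurableSpace Ω] (P : Measure Ω) [IsProbabilityMeasure P]
        (X : Fin n → Ω → EuclideanSpace ℝ (Fin d)),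
        (∀ i, Measurable (X i)) →
        iIndepFun X P →
        (∀ i, P.map (X i) = uniformOn (GreedySearch.signCube d)) →
        9 / 10 < P {ω | ∀ G : Digraph (Fin n),
          GreedySearch.Navigable G dist (fun i => X i ω) →
          K * (n : ℝ) ^ ((3 : ℝ) / 2 -
              max (Real.logb 2 (Real.logb 2 n) / Real.logb 2 n)
                (c * Real.sqrt (Real.logb 2 n / d)))
            ≤ (GreedySearch.numEdges G : ℝ)} := by
  refine ⟨196608, 1 / 1200, by norm_num, by norm_num, 10 ^ 7, ?_⟩
  intro n hn d hd Ω _ P _ X hX hind hunif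
  exact GreedySearch.lt_measure_of_freq_le P X hX hind hunif
    (fun y => ∀ G : Digraph (Fin n), GreedySearch.Navigable G dist y →
      1 / 1200 * (n : ℝ) ^ ((3 : ℝ) / 2 - GreedySearch.exponentLoss 196608 n d)
        ≤ (GreedySearch.numEdges G : ℝ))
    (GreedySearch.freq_not_edge_rpow_bound hn hd)
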